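/- Let $p$ be a prime and let $G$ be a profinite group that is a semidirect product $G=H\rtimes\Gamma$, where the subgroups $H$ (normal in $G$) and $\Gamma$ are both isomorphic, as topological groups, to the additive group $\mathbb{Z}_p$. For a profinite group $K$ let $\Lambda(K)=\mathbb{Z}_p[\![K]\!]=\varprojlim_U\mathbb{Z}_p[K/U]$, with $U$ running over the open normal subgroups of $K$. For $m\ge 0$ put $H_m=H^{p^m}$, let $I_{H_m}$ be the kernel of the augmentation $\Lambda(H_m)\to\mathbb{Z}_p$, and for a left $\Lambda(G)$-module $X$ put $X_{H_m}=X/I_{H_m}X$. There exist functions $A\mapsto\mu_A$, $A\mapsto\nu_A$ and $B\mapsto\nu_B$ from left $\Lambda(G)$-modules to the non-negative integers such that the following holds. Let $X$ be a finitely generated left $\Lambda(G)$-module in which every element is killed by a power of $p$, and let $$0\to A\to X\to\bigoplus_{i=1}^s\Lambda(G)/p^{m_i}\Lambda(G)\to B\to 0$$ be an exact sequence of left $\Lambda(G)$-modules (with $s\ge 0$ and $m_i\ge 0$) such that $A$ and $B$ are finitely generated over $\Lambda(H)$. Then for all sufficiently large $m$ the $\Lambda(\Gamma)$-module $X_{H_m}$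 has a largest finite $\Lambda(\Gamma)$-submodule $X'_{H_m}$, and $$\# X'_{H_m}=p^{\mu_A p^m+\nu_A+\nu_B}.$$ -/

import Mathlib

universe u v w

/-- The completed group algebra `ℤ_p⟦G⟧ = lim ℤ_p[G/U]` of a (profinite) group `G`, where `U` runs
over the open normal subgroups of `G`: the ring of all families of elements of the group algebras
`ℤ_p[G/U]` that are compatible with the projections `ℤ_p[G/U] → ℤ_p[G/V]` for `U ≤ V`. -/
noncomputable def completedGroupAlgebra (p : ℕ) [Fact p.Prime] (G : Type u) [Group G] [TopologicalSpace G] :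
    Subring ((U : OpenNormalSubgroup G) → MonoidAlgebra ℤ_[p] (G ⧸ U.toSubgroup)) where
  carrier := {x | ∀ (U V : OpenNormalSubgroup G) (h : U.toSubgroup ≤ V.toSubgroup),
    MonoidAlgebra.mapDomainRingHom ℤ_[p]
      (QuotientGroup.map U.toSubgroup V.toSubgroup (MonoidHom.id G)
        (h.trans_eq (Subgroup.comap_id _).symm)) (x U) = x V}
  mul_mem' := fun {a b} ha hb U V h => by
    rw [Pi.mul_apply, map_mul, ha U V h, hb U V h, Pi.mul_apply]
  one_mem' := fun U V h => by rw [Pi.one_apply, map_one, Pi.one_apply]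
  add_mem' := fun {a b} ha hb U V h => by
    rw [Pi.add_apply, map_add, ha U V h, hb U V h, Pi.add_apply]
  zero_mem' := fun U V h => by rw [Pi.zero_apply, map_zero, Pi.zero_apply]
  neg_mem' := fun {a} ha U V h => by rw [Pi.neg_apply, map_neg, ha U V h, Pi.neg_apply]

namespace completedGroupAlgebra

section

variable (p : ℕ) [Fact p.Prime] {G : Type u} [Group G] [TopologicalSpace G]

/-- The preimage of an open normal subgroup under a continuous homomorphism. -/
def comapOpenNormal {H : Type v} [Group H] [TopologicalSpace H] (f : H →ₜ* G)
    (V : OpenNormalSubgroup G) : OpenNormalSubgroup H where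
  toOpenSubgroup := V.toOpenSubgroup.comap f.toMonoidHom f.continuous_toFun
  isNormal' := Subgroup.Normal.comap V.isNormal' f.toMonoidHom

/-- The ring homomorphism `ℤ_p⟦H⟧ → ℤ_p⟦G⟧` induced by a continuous homomorphism `f : H → G`. Its
component at `V` is the composite `ℤ_p⟦H⟧ → ℤ_p[H/f⁻¹V] → ℤ_p[G/V]`. -/
noncomputable def map {H : Type v} [Group H] [TopologicalSpace H] (f : H →ₜ* G) :
    completedGroupAlgebra p H →+* completedGroupAlgebra p G :=
  RingHom.codRestrict
    ((RingHom.pi fun V : OpenNormalSubgroup G =>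
      (MonoidAlgebra.mapDomainRingHom ℤ_[p]
        (QuotientGroup.map (comapOpenNormal f V).toSubgroup V.toSubgroup f.toMonoidHom
          le_rfl)).comp
        (Pi.evalRingHom (fun U : OpenNormalSubgroup H => MonoidAlgebra ℤ_[p] (H ⧸ U.toSubgroup))
          (comapOpenNormal f V))).comp (completedGroupAlgebra p H).subtype)
    (completedGroupAlgebra p G)
    (by
      intro x V W h
      have hx := x.2 (comapOpenNormal f V) (comapOpenNormal f W) (Subgroup.comap_mono h)
      change MonoidAlgebra.mapDomainRingHom ℤ_[p] _ (MonoidAlgebra.mapDomainRingHom ℤ_[p] _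
        (x.1 (comapOpenNormal f V))) =
          MonoidAlgebra.mapDomainRingHom ℤ_[p] _ (x.1 (comapOpenNormal f W))
      rw [← hx, ← RingHom.comp_apply, ← RingHom.comp_apply, ← MonoidAlgebra.mapDomainRingHom_comp,
        ← MonoidAlgebra.mapDomainRingHom_comp]
      congr 2
      ext g
      rfl)

/-- The natural ring homomorphism `ℤ_p⟦K⟧ → ℤ_p⟦G⟧` for a subgroup `K` of `G` (with the subspace
topology). -/
noncomputable def ofSubgroup (K : Subgroup G) : completedGroupAlgebra p K →+* completedGroupAlgebra p G :=
  map p ⟨K.subtype, continuous_subtype_val⟩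

/-- The augmentation `ℤ_p⟦G⟧ → ℤ_p`, i.e. the composite `ℤ_p⟦G⟧ → ℤ_p[G/G] → ℤ_p`, where the last
map sends every group element to `1`. -/
noncomputable def augmentation (G : Type u) [Group G] [TopologicalSpace G] :
    completedGroupAlgebra p G →+* ℤ_[p] :=
  ((MonoidAlgebra.lift ℤ_[p] ℤ_[p] (G ⧸ (⊤ : Subgroup G)) 1 :
      MonoidAlgebra ℤ_[p] (G ⧸ (⊤ : Subgroup G)) →ₐ[ℤ_[p]] ℤ_[p]) :
      MonoidAlgebra ℤ_[p] (G ⧸ (⊤ : Subgroup G)) →+* ℤ_[p]).comp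
    ((Pi.evalRingHom (fun U : OpenNormalSubgroup G => MonoidAlgebra ℤ_[p] (G ⧸ U.toSubgroup))
      { toOpenSubgroup := ⊤, isNormal' := Subgroup.normal_top }).comp
        (completedGroupAlgebra p G).subtype)

end

end completedGroupAlgebra

/-- `H ^ n`: the subgroup generated by the `n`-th powers of the elements of `H`. -/
def subgroupPow {G : Type u} [Group G] (H : Subgroup G) (n : ℕ) : Subgroup G :=
  Subgroup.closure {g | ∃ h ∈ H, g = h ^ n}

/-- The abelian group `M`, viewed as an `R`-module by restriction of scalars along `f : R →+* S`
(the rings need not be commutative). -/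
def ScalarRestriction {R : Type u} {S : Type v} [Ring R] [Ring S] (_f : R →+* S) (M : Type w) :
    Type w := M

instance {R : Type u} {S : Type v} [Ring R] [Ring S] (f : R →+* S) (M : Type w)
    [AddCommGroup M] : AddCommGroup (ScalarRestriction f M) :=
  inferInstanceAs (AddCommGroup M)

instance {R : Type u} {S : Type v} [Ring R] [Ring S] (f : R →+* S) (M : Type w)
    [AddCommGroup M] [Module S M] : Module R (ScalarRestriction f M) :=
  Module.compHom M f

section

variable (p : ℕ) [Fact p.Prime] {G : Type u} [Group G] [TopologicalSpace G]

/-- The `ℤ_p⟦G⟧`-module `M`, viewed as a `ℤ_p⟦K⟧`-module, for a subgroup `K` of `G`. -/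
noncomputable abbrev RestrictTo (K : Subgroup G) (M : Type v) : Type v :=
  ScalarRestriction (completedGroupAlgebra.ofSubgroup p K) M

/-- `I_K X`, where `I_K` is the kernel of the augmentation `ℤ_p⟦K⟧ → ℤ_p` of a subgroup `K` of `G`
and `X` is a left `ℤ_p⟦G⟧`-module: the submodule of `X` generated by the products `a x` with
`a ∈ I_K` and `x ∈ X`. -/
noncomputable def augmentationSubmodule (K : Subgroup G) (X : Type v) [AddCommGroup X]
    [Module (completedGroupAlgebra p G) X] : Submodule (completedGroupAlgebra p G) X :=
  Submodule.span (completedGroupAlgebra p G)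
    {y | ∃ a ∈ RingHom.ker (completedGroupAlgebra.augmentation p K), ∃ x : X,
      y = completedGroupAlgebra.ofSubgroup p K a • x}

/-- The coinvariants `X_K = X / I_K X`. -/
noncomputable abbrev Coinvariants (K : Subgroup G) (X : Type v) [AddCommGroup X]
    [Module (completedGroupAlgebra p G) X] : Type v :=
  X ⧸ augmentationSubmodule p K X

/-- The sum `⊕ ℤ_p⟦G⟧ / p ^ (k i) ℤ_p⟦G⟧` over `i = 1, …, s`, as a left `ℤ_p⟦G⟧`-module. As `p` is
central, the left ideal generated by `p ^ (k i)` is the right ideal generated by it. -/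
noncomputable abbrev ElementaryModule (G : Type u) [Group G] [TopologicalSpace G] {s : ℕ} (k : Fin s → ℕ) :
    Type u :=
  DirectSum (Fin s) fun i =>
    completedGroupAlgebra p G ⧸
      Submodule.span (completedGroupAlgebra p G) {(p : completedGroupAlgebra p G) ^ k i}

end

/-! Write E for the elementary module, t and γ for topological generators of H and Γ, and T =
t^(p^m) - 1. As H_m is closed, normal and topologically generated by t^(p^m), the submodule I_{H_m}X
is just TX (`mem_augmentationSubmodule_iff`). Multiplication by T is injective on E
(`smul_injective_elementaryModule`), so a snake argument makes the kernel of X/TX → E/TE an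
extension of the T-torsion of B by A/TA (`AddMonoidHom.card_map_comap_range`).

This kernel is the largest finite submodule. Each element of a finite Λ(Γ)-submodule is fixed by
some γ^n with n ≥ 1, while γ^n - 1 is injective on E/TE because γ^n has infinite order modulo H_m
(`exists_eq_smul_elementaryModule`).

It remains to count. A and B are finitely generated over the commutative ring Λ(H) and killed by a
power of p. On a module killed by p, T acts as (t - 1)^(p^m), so its Herbrand quotient #coker/#ker
is the p^m-th power of that of t - 1; dévissage along pM ⊆ M gives the same exponential growth in
general. The kernels increase with m and stabilise because the modules are noetherian. Hence #ker =
p^ν and #coker = p^(μp^m + ν) for large m (`exists_card_omegaElement_eq`).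

The facts about Λ come from finite quotients, without power series. `DvdModulo N c x` expresses that
c divides the image of x in Λ(G/N). Compactness turns it into x ∈ cΛ + (τ - 1)Λ, for τ a topological
generator of N (`DvdModulo.exists_eq`), and a sum over orbits shows that g - 1 can be cancelled when
g has infinite order modulo N (`DvdModulo.of_sub_one_mul`). -/

/-! ### Divisibility in group algebras of discrete groups -/

section GroupAlgebra

variable {R : Type*} [CommRing R] {Q Q' : Type*} [Group Q] [Group Q']

theorem MonoidAlgebra.coeff_natCast_mul (c : ℕ) (y : MonoidAlgebra R Q) (q : Q) :
    ((c : MonoidAlgebra R Q) * y).coeff q = c * y.coeff q := by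
  rw [← nsmul_eq_mul, coeff_smul, Finsupp.smul_apply, nsmul_eq_mul]

theorem MonoidAlgebra.natCast_dvd_iff (c : ℕ) (x : MonoidAlgebra R Q) :
    (c : MonoidAlgebra R Q) ∣ x ↔ ∀ q, (c : R) ∣ x.coeff q := by
  classical
  constructor
  · rintro ⟨y, rfl⟩ q
    exact ⟨y.coeff q, coeff_natCast_mul ..⟩
  · intro h
    choose y hy using h
    -- The chosen cofactors `y q` may be nonzero off the support of `x`, so they are replaced by 0
    -- there.
    refine ⟨.ofCoeff (Finsupp.onFinset x.coeff.support
      (fun q => if x.coeff q = 0 then 0 else y q) (by intro q hq; simp_all)), ?_⟩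
    ext q
    refine Eq.trans ?_ (coeff_natCast_mul ..).symm
    change _ = (c : R) * (if x.coeff q = 0 then 0 else y q)
    split_ifs with hq
    · rw [hq, mul_zero]
    · exact hy q

/-- If the fibres of `f` are orbits under left multiplication by the powers of `t`, then an element
whose image under `f` is divisible by `c` lies in the right ideal generated by `c` and `t - 1`. -/
theorem MonoidAlgebra.exists_eq_natCast_mul_add (f : Q →* Q') (hf : Function.Surjective f) (t : Q)
    (hfib : ∀ a b, f a = f b → ∃ n : ℕ, b = t ^ n * a) (c : ℕ) (x : MonoidAlgebra R Q)
    (hx : (c : MonoidAlgebra R Q') ∣ mapDomainRingHom R f x) :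
    ∃ y z, x = (c : MonoidAlgebra R Q) * y + (single t 1 - 1) * z := by
  -- A group element and the chosen representative of its fibre differ by a power of t, and t^n - 1
  -- is a multiple of t - 1.
  have key : ∀ x : MonoidAlgebra R Q, ∃ z,
      x = mapDomain (Function.surjInv hf) (mapDomainRingHom R f x) + (single t 1 - 1) * z := by
    intro x
    induction x using MonoidAlgebra.induction_linear with
    | zero => exact ⟨0, by simp⟩
    | add x y hx hy =>
      obtain ⟨z, hz⟩ := hx
      obtain ⟨w, hw⟩ := hy
      refine ⟨z + w, ?_⟩
      rw [map_add, mapDomain_add, mul_add]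
      nth_rw 1 [hz, hw]
      abel
    | single a r =>
      obtain ⟨n, hn⟩ := hfib (Function.surjInv hf (f a)) a (Function.surjInv_eq hf _)
      refine ⟨(∑ i ∈ Finset.range n, (single t (1 : R)) ^ i) *
        single (Function.surjInv hf (f a)) r, ?_⟩
      rw [← mul_assoc, mul_geom_sum, single_pow, one_pow, sub_mul, one_mul, single_mul_single,
        one_mul, ← hn]
      simp
  obtain ⟨w, hw⟩ := hx
  obtain ⟨z, hz⟩ := key x
  refine ⟨mapDomain (Function.surjInv hf) w, z, ?_⟩
  rw [hz, hw]
  congr 1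
  rw [← nsmul_eq_mul, ← nsmul_eq_mul]
  exact map_nsmul (mapDomainLinearMap R R (Function.surjInv hf)) c w

/-- A function which is invariant under left translation by `s` has sum zero if the order of `s`
vanishes in the coefficients. -/
theorem sum_eq_zero_of_translation_invariant {k : Type*} [CommRing k] [Fintype Q] (s : Q)
    (hs : (orderOf s : k) = 0) (F : Q → k) (hF : ∀ g, F (s * g) = F g) : ∑ g, F g = 0 := by
  classical
  have hF' : ∀ g, ∀ σ ∈ Subgroup.zpowers s, F (σ * g) = F g := by
    intro g σ hσ
    obtain ⟨n, rfl⟩ := (Submonoid.mem_powers_iff _ _).1 (mem_powers_iff_mem_zpowers.2 hσ)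
    induction n with
    | zero => simp
    | succ n ih =>
      rw [pow_succ', mul_assoc, hF]
      exact ih (Subgroup.npow_mem_zpowers s n)
  have hbij : Function.Bijective
      fun a : (Q ⧸ Subgroup.zpowers s) × Subgroup.zpowers s => a.1.out * (a.2 : Q) := by
    constructor
    · rintro ⟨q, σ⟩ ⟨q', σ'⟩ h
      have h1 : q = q' := by
        have := congrArg (QuotientGroup.mk (s := Subgroup.zpowers s)) h
        simpa using this
      subst h1
      simpa using h
    · intro g
      refine ⟨⟨g, ⟨(g : Q ⧸ Subgroup.zpowers s).out⁻¹ * g, ?_⟩⟩, by simp⟩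
      rw [← QuotientGroup.eq, QuotientGroup.out_eq']
  -- The decomposition is into cosets g⟨s⟩ but `F` is invariant on the other side; inversion
  -- exchanges the sides. Each coset then contributes `orderOf s` equal terms.
  rw [← Equiv.sum_comp (Equiv.inv Q), ← hbij.sum_comp, Fintype.sum_prod_type]
  refine Finset.sum_eq_zero fun q _ => ?_
  have : ∀ σ : Subgroup.zpowers s, F ((Equiv.inv Q) (q.out * (σ : Q))) = F (q.out⁻¹) := by
    intro σ
    rw [Equiv.inv_apply, mul_inv_rev, hF' _ _ (inv_mem σ.2)]
  rw [Finset.sum_congr rfl fun σ _ => this σ, Finset.sum_const, Finset.card_univ,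
    Fintype.card_zpowers, nsmul_eq_mul, hs, zero_mul]

/-- If `t` has `c` times as large an order as its image under `f`, then `t - 1` is a
non-zero-divisor modulo `c` up to the kernel of `f`. -/
theorem MonoidAlgebra.natCast_dvd_map_of_dvd_sub_one_mul [Finite Q] (f : Q →* Q') (t : Q) (c : ℕ)
    (ht : c * orderOf (f t) ∣ orderOf t) (x : MonoidAlgebra R Q)
    (hx : (c : MonoidAlgebra R Q) ∣ (single t 1 - 1) * x) :
    (c : MonoidAlgebra R Q') ∣ mapDomainRingHom R f x := by
  classical
  have := Fintype.ofFinite Q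
  rw [natCast_dvd_iff] at hx ⊢
  intro q
  let k := R ⧸ Ideal.span {(c : R)}
  let φ : R →+* k := Ideal.Quotient.mk _
  have hφ : ∀ r, φ r = 0 ↔ (c : R) ∣ r := fun r => by
    rw [Ideal.Quotient.eq_zero_iff_mem, Ideal.mem_span_singleton]
  -- The coefficient of (t - 1)x at tg is x(g) - x(tg), so modulo c the coefficients of x are
  -- constant along the orbits of t.
  have hinv : ∀ g, φ (x.coeff (t * g)) = φ (x.coeff g) := by
    intro g
    have := hx (t * g)
    rw [sub_mul, one_mul, coeff_sub, Finsupp.sub_apply, coeff_single_mul_apply, one_mul, inv_mul_cancel_left, ← hφ, map_sub,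
      sub_eq_zero] at this
    exact this.symm
  have hpow : ∀ (n : ℕ) g, φ (x.coeff (t ^ n * g)) = φ (x.coeff g) := by
    intro n g
    induction n with
    | zero => simp
    | succ n ih => rw [pow_succ', mul_assoc, hinv, ih]
  set s := t ^ orderOf (f t) with hs
  have hfs : f s = 1 := by rw [hs, map_pow, pow_orderOf_eq_one]
  have hord : (orderOf s : k) = 0 := by
    have h1 : c ∣ orderOf s := by
      rw [hs, orderOf_pow, Nat.gcd_eq_right ((dvd_mul_left _ _).trans ht)]
      exact (Nat.dvd_div_iff_mul_dvd ((dvd_mul_left _ _).trans ht)).2 (by rwa [mul_comm])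
    obtain ⟨d, hd⟩ := h1
    have : φ (c : R) = 0 := (hφ _).2 dvd_rfl
    rw [hd, Nat.cast_mul, ← map_natCast φ c, this, zero_mul]
  rw [← hφ]
  have hsum : (mapDomainRingHom R f x).coeff q = ∑ g, if f g = q then x.coeff g else 0 := by
    change Finsupp.mapDomain f x.coeff q = _
    rw [Finsupp.mapDomain, Finsupp.sum_fintype _ _ (by simp), Finsupp.finsetSum_apply]
    exact Finset.sum_congr rfl fun g _ => by rw [Finsupp.single_apply]
  rw [hsum, map_sum]
  refine sum_eq_zero_of_translation_invariant s hord _ fun g => ?_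
  rw [map_mul, hfs, one_mul]
  split_ifs
  · exact hpow _ _
  · rfl

end GroupAlgebra

/-! ### Completed group algebras and passage to finite quotients -/

namespace completedGroupAlgebra

section

variable (p : ℕ) [Fact p.Prime] {G : Type u} [Group G] [TopologicalSpace G]

/-- The projection `ℤ_p[G/U] → ℤ_p[G/V]` for `U ≤ V`. -/
noncomputable def transition {U V : OpenNormalSubgroup G} (h : U.toSubgroup ≤ V.toSubgroup) :
    MonoidAlgebra ℤ_[p] (G ⧸ U.toSubgroup) →+* MonoidAlgebra ℤ_[p] (G ⧸ V.toSubgroup) :=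
  MonoidAlgebra.mapDomainRingHom ℤ_[p]
    (QuotientGroup.map U.toSubgroup V.toSubgroup (MonoidHom.id G)
      (h.trans_eq (Subgroup.comap_id _).symm))

theorem transition_transition {U V W : OpenNormalSubgroup G} (h : U.toSubgroup ≤ V.toSubgroup)
    (h' : V.toSubgroup ≤ W.toSubgroup) (x : MonoidAlgebra ℤ_[p] (G ⧸ U.toSubgroup)) :
    transition p h' (transition p h x) = transition p (h.trans h') x := by
  rw [transition, transition, transition, ← RingHom.comp_apply,
    ← MonoidAlgebra.mapDomainRingHom_comp]
  congr 2
  ext g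
  rfl

theorem transition_single {U V : OpenNormalSubgroup G} (h : U.toSubgroup ≤ V.toSubgroup) (g : G)
    (r : ℤ_[p]) :
    transition p h (MonoidAlgebra.single (g : G ⧸ U.toSubgroup) r) =
      MonoidAlgebra.single (g : G ⧸ V.toSubgroup) r :=
  MonoidAlgebra.mapDomain_single

variable {p}

theorem transition_val (x : completedGroupAlgebra p G) {U V : OpenNormalSubgroup G}
    (h : U.toSubgroup ≤ V.toSubgroup) : transition p h (x.1 U) = x.1 V :=
  x.2 U V h

variable (p)

/-- The group element `g`, as an element of `ℤ_p⟦G⟧`. -/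
noncomputable def of : G →* completedGroupAlgebra p G where
  toFun g := ⟨fun U => MonoidAlgebra.single (g : G ⧸ U.toSubgroup) 1,
    fun _ _ h => transition_single p h g 1⟩
  map_one' := rfl
  map_mul' a b := by
    refine Subtype.ext (funext fun U => ?_)
    change MonoidAlgebra.single _ _ = MonoidAlgebra.single (a : G ⧸ U.toSubgroup) (1 : ℤ_[p]) *
      MonoidAlgebra.single (b : G ⧸ U.toSubgroup) 1
    rw [MonoidAlgebra.single_mul_single, one_mul]
    rfl

theorem of_val (g : G) (U : OpenNormalSubgroup G) :
    (of p g).1 U = MonoidAlgebra.single (g : G ⧸ U.toSubgroup) 1 := rfl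

theorem of_val_of_mem {g : G} {U : OpenNormalSubgroup G} (hg : g ∈ U.toSubgroup) :
    (of p g).1 U = 1 := by
  rw [of_val, (QuotientGroup.eq_one_iff g).2 hg]
  rfl

theorem map_of {H : Type v} [Group H] [TopologicalSpace H] (f : H →ₜ* G) (h : H) :
    map p f (of p h) = of p (f h) := by
  refine Subtype.ext (funext fun U => ?_)
  exact MonoidAlgebra.mapDomain_single

theorem ofSubgroup_of (K : Subgroup G) (k : K) : ofSubgroup p K (of p k) = of p (k : G) :=
  map_of p _ k

variable {p}

/-- Solvability of `x = a y + b z` in `ℤ_p⟦G⟧` can be tested on the finite quotients. -/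
theorem exists_eq_mul_add_mul [IsTopologicalGroup G] [CompactSpace G]
    (a b x : completedGroupAlgebra p G)
    (h : ∀ U, ∃ y z, x.1 U = a.1 U * y + b.1 U * z) : ∃ y z, x = a * y + b * z := by
  classical
  -- Coordinates identify each ℤ_p[G/U] with a finite power of ℤ_p, which is compact and on which
  -- linear maps are continuous.
  let e : ∀ U : OpenNormalSubgroup G,
      MonoidAlgebra ℤ_[p] (G ⧸ U.toSubgroup) ≃ₗ[ℤ_[p]] (G ⧸ U.toSubgroup → ℤ_[p]) := fun U =>
    (MonoidAlgebra.coeffLinearEquiv ℤ_[p]).trans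
      (Finsupp.linearEquivFunOnFinite ℤ_[p] ℤ_[p] (G ⧸ U.toSubgroup))
  let tr : ∀ {U V : OpenNormalSubgroup G} (_ : U.toSubgroup ≤ V.toSubgroup),
      MonoidAlgebra ℤ_[p] (G ⧸ U.toSubgroup) →ₗ[ℤ_[p]] MonoidAlgebra ℤ_[p] (G ⧸ V.toSubgroup) :=
    fun {U V} h => MonoidAlgebra.mapDomainLinearMap _ _ (QuotientGroup.map U.toSubgroup V.toSubgroup
      (MonoidHom.id G) (h.trans_eq (Subgroup.comap_id _).symm))
  have tr_eq : ∀ {U V : OpenNormalSubgroup G} (h : U.toSubgroup ≤ V.toSubgroup) y,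
    tr h y = transition p h y := fun _ _ => rfl
  -- `C V` consists of the families that solve the equation at V and whose components above V are
  -- the projections of the one at V. A point of all `C V` is a compatible system of solutions.
  let C : OpenNormalSubgroup G → Set (∀ U : OpenNormalSubgroup G,
      (G ⧸ U.toSubgroup → ℤ_[p]) × (G ⧸ U.toSubgroup → ℤ_[p])) := fun V =>
    {w | LinearMap.mulLeft ℤ_[p] (a.1 V) ((e V).symm (w V).1) +
        LinearMap.mulLeft ℤ_[p] (b.1 V) ((e V).symm (w V).2) = x.1 V} ∩
      {w | ∀ (U : OpenNormalSubgroup G) (h : V.toSubgroup ≤ U.toSubgroup),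
        (w U).1 = e U (tr h ((e V).symm (w V).1)) ∧ (w U).2 = e U (tr h ((e V).symm (w V).2))}
  have hC : (⋂ V, C V).Nonempty := by
    have : Nonempty (OpenNormalSubgroup G) :=
      ⟨{ toOpenSubgroup := ⊤, isNormal' := Subgroup.normal_top }⟩
    have hcl : ∀ V, IsClosed (C V) := by
      intro V
      have cont : ∀ {U : OpenNormalSubgroup G}
          (f : (G ⧸ V.toSubgroup → ℤ_[p]) →ₗ[ℤ_[p]] (G ⧸ U.toSubgroup → ℤ_[p])), Continuous f :=
        fun f => f.continuous_on_pi
      refine IsClosed.inter ?_ ?_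
      · have : {w : ∀ U : OpenNormalSubgroup G,
            (G ⧸ U.toSubgroup → ℤ_[p]) × (G ⧸ U.toSubgroup → ℤ_[p]) |
            LinearMap.mulLeft ℤ_[p] (a.1 V) ((e V).symm (w V).1) +
              LinearMap.mulLeft ℤ_[p] (b.1 V) ((e V).symm (w V).2) = x.1 V} =
            {w | ((e V).toLinearMap ∘ₗ LinearMap.mulLeft ℤ_[p] (a.1 V) ∘ₗ (e V).symm.toLinearMap)
              (w V).1 + ((e V).toLinearMap ∘ₗ LinearMap.mulLeft ℤ_[p] (b.1 V) ∘ₗ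
              (e V).symm.toLinearMap) (w V).2 = e V (x.1 V)} := by
          ext w
          simp only [Set.mem_ofPred_eq]
          rw [← (e V).injective.eq_iff, map_add]
          rfl
        rw [this]
        exact isClosed_eq (((cont _).comp (continuous_fst.comp (continuous_apply V))).add
          ((cont _).comp (continuous_snd.comp (continuous_apply V)))) continuous_const
      · simp only [Set.ofPred_forall]
        refine isClosed_iInter fun U => isClosed_iInter fun h => IsClosed.inter ?_ ?_
        · exact isClosed_eq (continuous_fst.comp (continuous_apply U))
            ((cont ((e U).toLinearMap ∘ₗ tr h ∘ₗ (e V).symm.toLinearMap)).comp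
              (continuous_fst.comp (continuous_apply V)))
        · exact isClosed_eq (continuous_snd.comp (continuous_apply U))
            ((cont ((e U).toLinearMap ∘ₗ tr h ∘ₗ (e V).symm.toLinearMap)).comp
              (continuous_snd.comp (continuous_apply V)))
    refine IsCompact.nonempty_iInter_of_directed_nonempty_isCompact_isClosed C ?_ ?_
      (fun V => (hcl V).isCompact) hcl
    · have mono : ∀ W V : OpenNormalSubgroup G, W.toSubgroup ≤ V.toSubgroup → C W ⊆ C V := by
        rintro W V hWV w ⟨hw, hw'⟩
        have h1 : (e V).symm (w V).1 = transition p hWV ((e W).symm (w W).1) := by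
          rw [(hw' V hWV).1, LinearEquiv.symm_apply_apply, tr_eq]
        have h2 : (e V).symm (w V).2 = transition p hWV ((e W).symm (w W).2) := by
          rw [(hw' V hWV).2, LinearEquiv.symm_apply_apply, tr_eq]
        refine ⟨?_, fun U h => ⟨?_, ?_⟩⟩
        · simp only [Set.mem_ofPred_eq, LinearMap.mulLeft_apply] at hw ⊢
          rw [h1, h2]
          rw [← transition_val x hWV, ← hw, map_add, map_mul, map_mul, transition_val,
            transition_val]
        · rw [h1, tr_eq h, transition_transition]
          exact (hw' U (hWV.trans h)).1
        · rw [h2, tr_eq h, transition_transition]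
          exact (hw' U (hWV.trans h)).2
      exact fun V V' => ⟨V ⊓ V', mono _ _ inf_le_left, mono _ _ inf_le_right⟩
    · intro V
      obtain ⟨y, z, hyz⟩ := h V
      -- Only components above V are constrained by `C V`; the others may be 0.
      refine ⟨fun U => if h : V.toSubgroup ≤ U.toSubgroup then (e U (tr h y), e U (tr h z)) else 0,
        ?_, fun U h => ?_⟩
      · have hid : ∀ y, transition p (le_refl V.toSubgroup) y = y := by
          intro y
          rw [transition, show QuotientGroup.map V.toSubgroup V.toSubgroup (MonoidHom.id G) _ =
            MonoidHom.id _ from QuotientGroup.map_id _, MonoidAlgebra.mapDomainRingHom_id]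
          rfl
        simp [tr_eq, hid, hyz]
      · simp [h, tr_eq, transition_transition]
  obtain ⟨w, hw⟩ := hC
  rw [Set.mem_iInter] at hw
  have hw1 : ∀ (U V : OpenNormalSubgroup G) (h : U.toSubgroup ≤ V.toSubgroup),
      transition p h ((e U).symm (w U).1) = (e V).symm (w V).1 := by
    intro U V h
    rw [((hw U).2 V h).1, LinearEquiv.symm_apply_apply, tr_eq]
  have hw2 : ∀ (U V : OpenNormalSubgroup G) (h : U.toSubgroup ≤ V.toSubgroup),
      transition p h ((e U).symm (w U).2) = (e V).symm (w V).2 := by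
    intro U V h
    rw [((hw U).2 V h).2, LinearEquiv.symm_apply_apply, tr_eq]
  refine ⟨⟨fun U => (e U).symm (w U).1, hw1⟩, ⟨fun U => (e U).symm (w U).2, hw2⟩, ?_⟩
  exact Subtype.ext (funext fun U => (hw U).1.symm)

/-- All coefficients of the components of `x` at the open normal subgroups containing `N` are
divisible by `c`. -/
def DvdModulo (N : Subgroup G) (c : ℕ) (x : completedGroupAlgebra p G) : Prop :=
  ∀ U : OpenNormalSubgroup G, N ≤ U.toSubgroup →
    (c : MonoidAlgebra ℤ_[p] (G ⧸ U.toSubgroup)) ∣ x.1 U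

/-- At every level containing N the element t becomes 1, which kills the second summand. This is the
converse of `DvdModulo.exists_eq`. -/
theorem dvdModulo_of_eq {N : Subgroup G} {c : ℕ} {t : G} (ht : t ∈ N)
    {x y z : completedGroupAlgebra p G} (h : x = c * y + (of p t - 1) * z) : DvdModulo N c x := by
  intro U hU
  have : x.1 U = c * y.1 U + ((of p t).1 U - 1) * z.1 U := congrArg (fun w => w.1 U) h
  rw [this, of_val_of_mem p (hU ht), sub_self, zero_mul, add_zero]
  exact dvd_mul_right _ _

/-- The right ideal generated by `c` and `t - 1`, if `t` topologically generates the normal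
subgroup `N`. -/
theorem DvdModulo.exists_eq [IsTopologicalGroup G] [CompactSpace G] {N : Subgroup G} (hN : N.Normal)
    {t : G} (ht : ∀ (U : OpenNormalSubgroup G), ∀ g ∈ N, ∃ n : ℕ, g * (t ^ n)⁻¹ ∈ U.toSubgroup)
    {c : ℕ} {x : completedGroupAlgebra p G} (hx : DvdModulo N c x) :
    ∃ y z, x = c * y + (of p t - 1) * z := by
  refine exists_eq_mul_add_mul _ _ x fun U => ?_
  -- The hypothesis speaks only of levels containing N, hence V = UN. The fibres of G/U → G/UN are
  -- the cosets of the image of N, which consists of powers of t.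
  let V : OpenNormalSubgroup G :=
    { toSubgroup := U.toSubgroup ⊔ N
      isOpen' := Subgroup.isOpen_mono le_sup_left U.isOpen'
      isNormal' := Subgroup.sup_normal _ _ }
  have hUV : U.toSubgroup ≤ V.toSubgroup := le_sup_left
  have hV := hx V le_sup_right
  rw [← transition_val x hUV] at hV
  refine MonoidAlgebra.exists_eq_natCast_mul_add _ ?_ (t : G ⧸ U.toSubgroup) ?_ c (x.1 U) hV
  · intro q
    obtain ⟨g, rfl⟩ := QuotientGroup.mk_surjective q
    exact ⟨g, rfl⟩
  · intro a b hab
    obtain ⟨a, rfl⟩ := QuotientGroup.mk_surjective a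
    obtain ⟨b, rfl⟩ := QuotientGroup.mk_surjective b
    have hmem : b * a⁻¹ ∈ V.toSubgroup := by
      have h1 : ((a : G) : G ⧸ V.toSubgroup) = b := hab
      rw [← QuotientGroup.eq_one_iff, QuotientGroup.mk_mul, QuotientGroup.mk_inv, h1,
        mul_inv_cancel]
    obtain ⟨r, hr, g, hg, hrg⟩ := Subgroup.mem_sup_of_normal_right.1 hmem
    obtain ⟨n, hn⟩ := ht U g hg
    refine ⟨n, ?_⟩
    have h1 : (r : G ⧸ U.toSubgroup) = 1 := (QuotientGroup.eq_one_iff r).2 hr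
    have h2 : (g : G ⧸ U.toSubgroup) = (t : G ⧸ U.toSubgroup) ^ n := by
      have := (QuotientGroup.eq_one_iff _).2 hn
      rwa [QuotientGroup.mk_mul, QuotientGroup.mk_inv, mul_inv_eq_one] at this
    rw [← h2, ← one_mul (g : G ⧸ U.toSubgroup), ← h1, ← QuotientGroup.mk_mul,
      ← QuotientGroup.mk_mul, hrg, inv_mul_cancel_right]

/-- If the order of `t` grows without bound in the finite quotients of `G/N`, then `t - 1` is a
non-zero-divisor modulo `c` and `N`. -/
theorem DvdModulo.of_sub_one_mul [IsTopologicalGroup G] [CompactSpace G] {N : Subgroup G} {t : G}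
    {c : ℕ}
    (ht : ∀ U : OpenNormalSubgroup G, N ≤ U.toSubgroup → ∃ V : OpenNormalSubgroup G,
      N ≤ V.toSubgroup ∧ V.toSubgroup ≤ U.toSubgroup ∧
      c * orderOf (t : G ⧸ U.toSubgroup) ∣ orderOf (t : G ⧸ V.toSubgroup))
    {x : completedGroupAlgebra p G} (hx : DvdModulo N c ((of p t - 1) * x)) : DvdModulo N c x := by
  intro U hU
  obtain ⟨V, hV, hVU, hord⟩ := ht U hU
  rw [← transition_val x hVU]
  exact MonoidAlgebra.natCast_dvd_map_of_dvd_sub_one_mul _ _ c hord _ (hx V hV)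

end

end completedGroupAlgebra

/-! ### Orders in exact sequences and Herbrand quotients -/

section SixTerm

variable {R : Type*} [Ring R]

theorem LinearMap.card_eq_of_exact {A B C : Type*} [AddCommGroup A] [Module R A] [AddCommGroup B]
    [Module R B] [AddCommGroup C] [Module R C] {f : A →ₗ[R] B} {g : B →ₗ[R] C}
    (h : Function.Exact f g) : Nat.card B = Nat.card (range f) * Nat.card (range g) := by
  rw [Submodule.card_eq_card_quotient_mul_card (ker g),
    Nat.card_congr g.quotKerEquivRange.toEquiv, h.linearMap_ker_eq, mul_comm]

theorem LinearMap.finite_of_exact {A B C : Type*} [AddCommGroup A] [Module R A] [AddCommGroup B]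
    [Module R B] [AddCommGroup C] [Module R C] {f : A →ₗ[R] B} {g : B →ₗ[R] C}
    (h : Function.Exact f g) [Finite A] [Finite C] : Finite B := by
  have : Finite (range f) := Set.finite_range f
  have : Finite (range g) := Finite.of_injective _ Subtype.val_injective
  exact Nat.finite_of_card_ne_zero (by
    rw [card_eq_of_exact h]
    exact Nat.mul_ne_zero Nat.card_pos.ne' Nat.card_pos.ne')

/-- The order of each module is the product of the orders of the images of the two adjacent maps, so
each image is counted once on either side. -/
theorem LinearMap.card_of_six_term_exact {A₀ A₁ A₂ A₃ A₄ A₅ : Type*}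
    [AddCommGroup A₀] [Module R A₀] [AddCommGroup A₁] [Module R A₁] [AddCommGroup A₂] [Module R A₂]
    [AddCommGroup A₃] [Module R A₃] [AddCommGroup A₄] [Module R A₄] [AddCommGroup A₅] [Module R A₅]
    {f₀ : A₀ →ₗ[R] A₁} {f₁ : A₁ →ₗ[R] A₂} {f₂ : A₂ →ₗ[R] A₃} {f₃ : A₃ →ₗ[R] A₄} {f₄ : A₄ →ₗ[R] A₅}
    (h₀ : Function.Injective f₀) (h₁ : Function.Exact f₀ f₁) (h₂ : Function.Exact f₁ f₂)
    (h₃ : Function.Exact f₂ f₃) (h₄ : Function.Exact f₃ f₄) (h₅ : Function.Surjective f₄) :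
    Nat.card A₀ * Nat.card A₂ * Nat.card A₄ = Nat.card A₁ * Nat.card A₃ * Nat.card A₅ := by
  rw [card_eq_of_exact h₁, card_eq_of_exact h₂, card_eq_of_exact h₃, card_eq_of_exact h₄,
    Nat.card_congr (LinearEquiv.ofInjective f₀ h₀).toEquiv, range_eq_top.2 h₅,
    Nat.card_congr (Submodule.topEquiv (R := R) (M := A₅)).toEquiv]
  ring

end SixTerm

section Herbrand

variable {R : Type*} [CommRing R]

open LinearMap in
/-- Multiplicativity of the Herbrand quotient `#coker f / #ker f` in short exact sequences. -/
theorem LinearMap.card_ker_mul_card_coker_of_exact {M' M M'' : Type*} [AddCommGroup M'] [Module R M']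
    [AddCommGroup M] [Module R M] [AddCommGroup M''] [Module R M''] {i : M' →ₗ[R] M}
    {q : M →ₗ[R] M''} (hi : Function.Injective i) (hiq : Function.Exact i q)
    (hq : Function.Surjective q) {f' : M' →ₗ[R] M'} {f : M →ₗ[R] M} {f'' : M'' →ₗ[R] M''}
    (h₁ : i.comp f' = f.comp i) (h₂ : q.comp f = f''.comp q)
    [Finite (ker f')] [Finite (M' ⧸ range f')] [Finite (ker f'')] [Finite (M'' ⧸ range f'')] :
    Finite (ker f) ∧ Finite (M ⧸ range f) ∧
      Nat.card (ker f') * Nat.card (ker f'') * Nat.card (M ⧸ range f) =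
        Nat.card (ker f) * Nat.card (M' ⧸ range f') * Nat.card (M'' ⧸ range f'') := by
  have e₁ : ∀ x, i (f' x) = f (i x) := LinearMap.congr_fun h₁
  have e₂ : ∀ x, q (f x) = f'' (q x) := LinearMap.congr_fun h₂
  let k₀ : ker f' →ₗ[R] ker f := i.restrict fun x hx => by
    rw [mem_ker] at hx ⊢; rw [← e₁, hx, map_zero]
  let k₁ : ker f →ₗ[R] ker f'' := q.restrict fun x hx => by
    rw [mem_ker] at hx ⊢; rw [← e₂, hx, map_zero]
  let c₀ : M' ⧸ range f' →ₗ[R] M ⧸ range f := Submodule.mapQ _ _ i (by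
    rintro _ ⟨x, rfl⟩; exact ⟨i x, (e₁ x).symm⟩)
  let c₁ : M ⧸ range f →ₗ[R] M'' ⧸ range f'' := Submodule.mapQ _ _ q (by
    rintro _ ⟨x, rfl⟩; exact ⟨q x, (e₂ x).symm⟩)
  let δ : ker f'' →ₗ[R] M' ⧸ range f' := SnakeLemma.δ' f' f f'' i q hiq i q hiq h₁ h₂
    (ker f'').subtype (exact_subtype_ker_map f'') (range f').mkQ (exact_map_mkQ_range f') hq hi
  have x₀ : Function.Injective k₀ := fun x y hxy =>
    Subtype.ext (hi (congrArg Subtype.val hxy))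
  have x₁ : Function.Exact k₀ k₁ := by
    rintro ⟨x, hx⟩
    constructor
    · intro h
      obtain ⟨y, rfl⟩ := (hiq x).1 (congrArg Subtype.val h)
      refine ⟨⟨y, hi ?_⟩, rfl⟩
      rw [e₁, map_zero]; exact hx
    · rintro ⟨y, hy⟩
      refine Subtype.ext ?_
      rw [← hy]
      exact hiq.apply_apply_eq_zero _
  have x₂ : Function.Exact k₁ δ := SnakeLemma.exact_δ'_right f' f f'' i q hiq i q hiq h₁ h₂
    (ker f).subtype (exact_subtype_ker_map f) (ker f'').subtype (exact_subtype_ker_map f'')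
    (range f').mkQ (exact_map_mkQ_range f') hq hi k₁ rfl Subtype.val_injective
  have x₃ : Function.Exact δ c₀ := SnakeLemma.exact_δ'_left f' f f'' i q hiq i q hiq h₁ h₂
    (ker f'').subtype (exact_subtype_ker_map f'') (range f').mkQ (exact_map_mkQ_range f')
    (range f).mkQ (exact_map_mkQ_range f) hq hi c₀ rfl (Submodule.mkQ_surjective _)
  have x₄ : Function.Exact c₀ c₁ := by
    intro x
    obtain ⟨x, rfl⟩ := Submodule.mkQ_surjective _ x
    constructor
    · intro h
      obtain ⟨y, hy⟩ := (Submodule.Quotient.mk_eq_zero _).1 h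
      obtain ⟨y, rfl⟩ := hq y
      rw [← e₂] at hy
      obtain ⟨z, hz⟩ := (hiq (x - f y)).1 (by rw [map_sub, hy, sub_self])
      refine ⟨Submodule.mkQ _ z, ?_⟩
      change Submodule.Quotient.mk (i z) = _
      rw [hz]
      exact (Submodule.Quotient.eq _).2 ⟨-y, by simp⟩
    · rintro ⟨y, hy⟩
      obtain ⟨y, rfl⟩ := Submodule.mkQ_surjective _ y
      rw [← hy]
      change Submodule.Quotient.mk (q (i y)) = _
      rw [hiq.apply_apply_eq_zero, Submodule.Quotient.mk_zero]
  have x₅ : Function.Surjective c₁ := by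
    intro x
    obtain ⟨x, rfl⟩ := Submodule.mkQ_surjective _ x
    obtain ⟨y, rfl⟩ := hq x
    exact ⟨Submodule.mkQ _ y, rfl⟩
  exact ⟨finite_of_exact x₁, finite_of_exact x₄, card_of_six_term_exact x₀ x₁ x₂ x₃ x₄ x₅⟩

/-- Multiplicativity of the Herbrand quotient `#coker f / #ker f` in compositions. -/
theorem LinearMap.card_ker_mul_card_coker_comp {M : Type*} [AddCommGroup M] [Module R M]
    (f g : M →ₗ[R] M) [Finite (ker f)] [Finite (M ⧸ range f)] [Finite (ker g)]
    [Finite (M ⧸ range g)] :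
    Finite (ker (f.comp g)) ∧ Finite (M ⧸ range (f.comp g)) ∧
      Nat.card (ker g) * Nat.card (ker f) * Nat.card (M ⧸ range (f.comp g)) =
        Nat.card (ker (f.comp g)) * Nat.card (M ⧸ range g) * Nat.card (M ⧸ range f) := by
  -- The sequence is 0 → ker g → ker fg → ker f → M/gM → M/fgM → M/fM → 0, with the connecting map
  -- induced by the identity of M.
  let k₀ : ker g →ₗ[R] ker (f.comp g) := Submodule.inclusion (ker_le_ker_comp g f)
  let k₁ : ker (f.comp g) →ₗ[R] ker f := g.restrict fun x hx => hx
  let δ : ker f →ₗ[R] M ⧸ range g := (range g).mkQ.comp (ker f).subtype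
  let c₀ : M ⧸ range g →ₗ[R] M ⧸ range (f.comp g) := Submodule.mapQ _ _ f (by
    rintro _ ⟨x, rfl⟩; exact ⟨x, rfl⟩)
  let c₁ : M ⧸ range (f.comp g) →ₗ[R] M ⧸ range f := Submodule.factor (range_comp_le_range g f)
  have x₁ : Function.Exact k₀ k₁ := by
    rintro ⟨x, hx⟩
    constructor
    · intro h
      exact ⟨⟨x, congrArg Subtype.val h⟩, rfl⟩
    · rintro ⟨y, hy⟩
      rw [← hy]
      exact Subtype.ext y.2
  have x₂ : Function.Exact k₁ δ := by
    rintro ⟨x, hx⟩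
    constructor
    · intro h
      obtain ⟨y, rfl⟩ := (Submodule.Quotient.mk_eq_zero _).1 h
      exact ⟨⟨y, hx⟩, rfl⟩
    · rintro ⟨y, hy⟩
      rw [← hy]
      exact (Submodule.Quotient.mk_eq_zero _).2 ⟨y.1, rfl⟩
  have x₃ : Function.Exact δ c₀ := by
    intro x
    obtain ⟨x, rfl⟩ := Submodule.mkQ_surjective _ x
    constructor
    · intro h
      obtain ⟨y, hy⟩ := (Submodule.Quotient.mk_eq_zero _).1 h
      refine ⟨⟨x - g y, ?_⟩, ?_⟩
      · rw [mem_ker, map_sub, ← hy]; exact sub_self _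
      · exact (Submodule.Quotient.eq _).2 ⟨-y, by simp⟩
    · rintro ⟨⟨y, hy⟩, hyx⟩
      rw [← hyx]
      change Submodule.Quotient.mk (f y) = _
      rw [mem_ker.1 hy, Submodule.Quotient.mk_zero]
  have x₄ : Function.Exact c₀ c₁ := by
    intro x
    obtain ⟨x, rfl⟩ := Submodule.mkQ_surjective _ x
    constructor
    · intro h
      obtain ⟨y, rfl⟩ := (Submodule.Quotient.mk_eq_zero _).1 h
      exact ⟨Submodule.mkQ _ y, rfl⟩
    · rintro ⟨y, hy⟩
      obtain ⟨y, rfl⟩ := Submodule.mkQ_surjective _ y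
      rw [← hy]
      exact (Submodule.Quotient.mk_eq_zero _).2 ⟨y, rfl⟩
  exact ⟨finite_of_exact x₁, finite_of_exact x₄, card_of_six_term_exact
    (Submodule.inclusion_injective _) x₁ x₂ x₃ x₄ (Submodule.factor_surjective _)⟩

/-- Multiplicativity under composition gives h(f^n) = h(f)^n for the Herbrand quotient h;
cross-multiplication keeps the identity in ℕ. -/
theorem LinearMap.card_ker_mul_card_coker_pow {M : Type*} [AddCommGroup M] [Module R M]
    (f : M →ₗ[R] M) [Finite (ker f)] [Finite (M ⧸ range f)] (n : ℕ) :
    Finite (ker (f ^ n)) ∧ Finite (M ⧸ range (f ^ n)) ∧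
      Nat.card (M ⧸ range (f ^ n)) * Nat.card (ker f) ^ n =
        Nat.card (ker (f ^ n)) * Nat.card (M ⧸ range f) ^ n := by
  induction n with
  | zero =>
    have h1 : ker (f ^ 0) = ⊥ := LinearMap.ker_id
    have h2 : range (f ^ 0) = ⊤ := LinearMap.range_id
    rw [h1, h2]
    have : Subsingleton (M ⧸ (⊤ : Submodule R M)) := Submodule.Quotient.subsingleton_iff.2 rfl
    exact ⟨inferInstance, inferInstance, by simp⟩
  | succ n ih =>
    obtain ⟨h1, h2, h3⟩ := ih
    obtain ⟨h4, h5, h6⟩ := card_ker_mul_card_coker_comp (f ^ n) f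
    change Finite (ker ((f ^ n).comp f)) ∧ Finite (M ⧸ range ((f ^ n).comp f)) ∧
      Nat.card (M ⧸ range ((f ^ n).comp f)) * _ = Nat.card (ker ((f ^ n).comp f)) * _
    refine ⟨h4, h5, ?_⟩
    have hpos : 0 < Nat.card (ker (f ^ n)) := Nat.card_pos
    apply Nat.eq_of_mul_eq_mul_left hpos
    calc _ = (Nat.card (ker f) * Nat.card (ker (f ^ n)) * Nat.card (M ⧸ range ((f ^ n).comp f))) *
          Nat.card (ker f) ^ n := by ring
      _ = Nat.card (ker ((f ^ n).comp f)) * Nat.card (M ⧸ range f) *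
          (Nat.card (M ⧸ range (f ^ n)) * Nat.card (ker f) ^ n) := by rw [h6]; ring
      _ = _ := by rw [h3]; ring

end Herbrand

/-! ### The kernel of X/tX → E/tE -/

/-- For an exact sequence `0 → A → X → E → B → 0` with endomorphisms such that the endomorphism `tE`
of `E` is injective, the kernel of `X/tX → E/tE` is an extension of `ker tB` by `A/tA`. -/
theorem AddMonoidHom.card_map_comap_range {A X E B Y : Type*} [AddCommGroup A] [AddCommGroup X]
    [AddCommGroup E] [AddCommGroup B] [AddCommGroup Y] {ι : A →+ X} {φ : X →+ E} {π : E →+ B}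
    (hι : Function.Injective ι) (hιφ : Function.Exact ι φ) (hφπ : Function.Exact φ π)
    (hπ : Function.Surjective π) {tA : A →+ A} {tX : X →+ X} {tE : E →+ E} {tB : B →+ B}
    (hAX : ∀ a, ι (tA a) = tX (ι a)) (hXE : ∀ x, φ (tX x) = tE (φ x))
    (hEB : ∀ e, π (tE e) = tB (π e)) (htE : Function.Injective tE) {q : X →+ Y}
    (hq : q.ker = tX.range) :
    Nat.card ((tE.range.comap φ).map q) = Nat.card (A ⧸ tA.range) * Nat.card tB.ker := by
  set K := tE.range.comap φ
  -- `s x` is the unique e with tE e = φ x, so s is additive, and π ∘ s is the connecting map onto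
  -- ker tB.
  choose s hs using fun x : K => x.2
  have hψ : ∀ x y e, tE e = φ (x + y : K) → e = s x + s y := fun x y e he => by
    apply htE
    rw [he, map_add, hs, hs]
    exact map_add φ x.1 y.1
  let ψ : K →+ tB.ker :=
    { toFun x := ⟨π (s x), by
        rw [AddMonoidHom.mem_ker, ← hEB, hs]
        exact hφπ.apply_apply_eq_zero _⟩
      map_zero' := Subtype.ext (by
        have : s 0 = 0 := htE (by rw [hs, map_zero]; exact map_zero φ)
        change π (s 0) = 0
        rw [this, map_zero])
      map_add' x y := Subtype.ext (by
        change π (s (x + y)) = π (s x) + π (s y)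
        rw [hψ x y _ (hs _), map_add]) }
  have hψ_surj : Function.Surjective ψ := by
    rintro ⟨b, hb⟩
    obtain ⟨e, rfl⟩ := hπ b
    rw [AddMonoidHom.mem_ker, ← hEB] at hb
    obtain ⟨x, hx⟩ := (hφπ _).1 hb
    let x' : K := ⟨x, ⟨e, hx.symm⟩⟩
    refine ⟨x', Subtype.ext ?_⟩
    have : s x' = e := htE (by rw [hs]; exact hx)
    change π (s x') = π e
    rw [this]
  -- `L` is the kernel of the connecting map. The index of tX(X) in K splits at L: the upper factor
  -- is #ker tB, the lower one #(A/tA).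
  set L := tX.range ⊔ ι.range
  have hLK : L ≤ K := by
    refine sup_le ?_ ?_
    · rintro _ ⟨x, rfl⟩
      exact ⟨φ x, (hXE x).symm⟩
    · rintro _ ⟨a, rfl⟩
      exact ⟨0, by rw [map_zero, hιφ.apply_apply_eq_zero]⟩
  have hker : ψ.ker = L.addSubgroupOf K := by
    ext x
    rw [AddMonoidHom.mem_ker, AddSubgroup.mem_addSubgroupOf, AddSubgroup.mem_sup]
    constructor
    · intro h
      obtain ⟨y, hy⟩ := (hφπ _).1 (congrArg Subtype.val h)
      have h1 : φ (x - tX y) = 0 := by rw [map_sub, hXE, hy, hs, sub_self]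
      obtain ⟨a, ha⟩ := (hιφ _).1 h1
      exact ⟨_, ⟨y, rfl⟩, _, ⟨a, rfl⟩, by rw [ha]; abel⟩
    · rintro ⟨_, ⟨y, rfl⟩, _, ⟨a, rfl⟩, h⟩
      have : s x = φ y := htE (by
        rw [hs, ← h, map_add, hιφ.apply_apply_eq_zero, add_zero, hXE])
      refine Subtype.ext ?_
      change π (s x) = 0
      rw [this, hφπ.apply_apply_eq_zero]
  rw [← AddSubgroup.relIndex_ker, hq, ← AddSubgroup.relIndex_mul_relIndex _ L K le_sup_left hLK]
  congr 1
  · rw [show L = tX.range ⊔ ι.range from rfl, sup_comm, AddSubgroup.relIndex_sup_right,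
      ← AddSubgroup.index_comap, AddSubgroup.index]
    -- If tX x lies in ι(A), then tE(φ x) = 0, so φ x = 0 and x itself comes from A.
    have : tX.range.comap ι = tA.range := by
      ext a
      constructor
      · rintro ⟨x, hx⟩
        have h1 : φ x = 0 := htE (by rw [← hXE, hx, hιφ.apply_apply_eq_zero, map_zero])
        obtain ⟨a', rfl⟩ := (hιφ x).1 h1
        exact ⟨a', hι (by rw [hAX, hx])⟩
      · rintro ⟨a', rfl⟩
        exact ⟨ι a', (hAX a').symm⟩
    rw [this]
  · rw [AddSubgroup.relIndex, ← hker, AddSubgroup.index_ker,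
      AddMonoidHom.range_eq_top.2 hψ_surj]
    exact Nat.card_congr AddSubgroup.topEquiv.toEquiv

/-! ### Growth of kernels and cokernels of (1 + T)^(p^m) - 1 -/

section Algebra

variable {R : Type*} [CommRing R]

/-- A finitely generated module killed by `I` is a quotient of a finite free `R/I`-module. -/
theorem Module.Finite.exists_surjective_of_killed (I : Ideal R) (M : Type*) [AddCommGroup M]
    [Module R M] [Module.Finite R M] (hI : ∀ a ∈ I, ∀ x : M, a • x = 0) :
    ∃ (n : ℕ) (f : (Fin n → R ⧸ I) →ₗ[R] M), Function.Surjective f := by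
  obtain ⟨n, g, hg⟩ := Module.Finite.exists_fin' R M
  let f : (Fin n → R ⧸ I) →ₗ[R] M := LinearMap.lsum R (fun _ => R ⧸ I) R fun i =>
    Submodule.liftQ I (LinearMap.toSpanSingleton R M (g (Pi.single i 1))) fun a ha => by
      rw [LinearMap.mem_ker, LinearMap.toSpanSingleton_apply, hI a ha]
  refine ⟨n, f, fun x => ?_⟩
  obtain ⟨r, rfl⟩ := hg x
  refine ⟨fun i => Submodule.Quotient.mk (r i), ?_⟩
  simp only [f, LinearMap.lsum_apply, LinearMap.sum_apply, LinearMap.comp_apply,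
    LinearMap.proj_apply]
  conv_rhs => rw [← LinearMap.sum_single_apply (fun _ => R) r, map_sum]
  refine Finset.sum_congr rfl fun i _ => ?_
  change r i • g (Pi.single i 1) = _
  rw [← map_smul, ← Pi.single_smul, smul_eq_mul, mul_one]

theorem Module.Finite.finite_of_killed (I : Ideal R) [Finite (R ⧸ I)] (M : Type*) [AddCommGroup M]
    [Module R M] [Module.Finite R M] (hI : ∀ a ∈ I, ∀ x : M, a • x = 0) : Finite M := by
  obtain ⟨n, f, hf⟩ := exists_surjective_of_killed I M hI
  exact _root_.Finite.of_surjective f hf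

theorem Module.Finite.isNoetherian_of_killed (I : Ideal R) [IsNoetherian R (R ⧸ I)] (M : Type*)
    [AddCommGroup M] [Module R M] [Module.Finite R M] (hI : ∀ a ∈ I, ∀ x : M, a • x = 0) :
    IsNoetherian R M := by
  obtain ⟨n, f, hf⟩ := exists_surjective_of_killed I M hI
  exact isNoetherian_of_surjective f (LinearMap.range_eq_top.2 hf)

theorem Nat.card_eq_prime_pow_of_killed {p : ℕ} (hp : p.Prime) {M : Type*} [AddCommGroup M] [Finite M]
    (k : ℕ) (h : ∀ x : M, p ^ k • x = 0) : ∃ n, Nat.card M = p ^ n := by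
  refine ⟨_, Nat.eq_prime_pow_of_unique_prime_dvd Nat.card_pos.ne' fun {q} hq hqd => ?_⟩
  have := Fact.mk hq
  obtain ⟨x, hx⟩ := exists_prime_addOrderOf_dvd_card' q hqd
  have h1 : q ∣ p ^ k := hx ▸ addOrderOf_dvd_of_nsmul_eq_zero (h x)
  exact (Nat.prime_dvd_prime_iff_eq hq hp).1 (hq.dvd_of_dvd_pow h1)

/-- The operator `(1 + T) ^ (p ^ m) - 1`. -/
def omegaElement (p : ℕ) (T : R) (m : ℕ) : R := (1 + T) ^ p ^ m - 1

theorem omegaElement_dvd_succ (p : ℕ) (T : R) (m : ℕ) :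
    omegaElement p T m ∣ omegaElement p T (m + 1) := by
  rw [omegaElement, omegaElement, pow_succ, pow_mul]
  exact sub_one_dvd_pow_sub_one _ _

/-- Frobenius modulo p: on modules killed by p the operator becomes a power of T. -/
theorem omegaElement_eq_pow_add (p : ℕ) [hp : Fact p.Prime] (T : R) (m : ℕ) :
    ∃ r, omegaElement p T m = T ^ p ^ m + p * r := by
  obtain ⟨r, hr⟩ := exists_add_pow_prime_pow_eq hp.out 1 T m
  exact ⟨T * r, by rw [omegaElement, hr, one_pow]; ring⟩

open LinearMap in
/-- Growth of the kernels and cokernels of `(1 + T) ^ (p ^ m) - 1` on a module killed by a power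
of `p`. -/
theorem card_ker_omegaElement_mul_pow (p : ℕ) [hp : Fact p.Prime] (T : R)
    [IsNoetherian R (R ⧸ Ideal.span {(p : R)})] [Finite (R ⧸ Ideal.span {(p : R), T})] (k : ℕ)
    (M : Type v) [AddCommGroup M] [Module R M] [Module.Finite R M] (hM : ∀ x : M, p ^ k • x = 0) :
    IsNoetherian R M ∧ ∃ c d : ℕ, 0 < c ∧ 0 < d ∧ ∀ m,
      Finite (ker (lsmul R M (omegaElement p T m))) ∧
      Finite (M ⧸ range (lsmul R M (omegaElement p T m))) ∧
      Nat.card (M ⧸ range (lsmul R M (omegaElement p T m))) * c ^ p ^ m =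
        Nat.card (ker (lsmul R M (omegaElement p T m))) * d ^ p ^ m := by
  induction k generalizing M with
  | zero =>
    have : Subsingleton M := ⟨fun x y => by
      rw [← one_nsmul x, ← one_nsmul y, ← pow_zero p, hM, hM]⟩
    refine ⟨inferInstance, 1, 1, one_pos, one_pos, fun m => ⟨inferInstance, inferInstance, ?_⟩⟩
    rw [Nat.card_of_subsingleton (0 : M ⧸ _), Nat.card_of_subsingleton (0 : ker _)]
  | succ k ih =>
    -- For modules killed by p, the constants c and d are the orders of the kernel and cokernel of
    -- T; both are finite, being finitely generated and killed by (p, T).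
    have key : ∀ (N : Type v) [AddCommGroup N] [Module R N] [Module.Finite R N],
        (∀ x : N, p • x = 0) → IsNoetherian R N ∧ ∃ c d : ℕ, 0 < c ∧ 0 < d ∧ ∀ m,
        Finite (ker (lsmul R N (omegaElement p T m))) ∧
        Finite (N ⧸ range (lsmul R N (omegaElement p T m))) ∧
        Nat.card (N ⧸ range (lsmul R N (omegaElement p T m))) * c ^ p ^ m =
          Nat.card (ker (lsmul R N (omegaElement p T m))) * d ^ p ^ m := by
      intro N _ _ _ hN
      have hN' : ∀ x : N, (p : R) • x = 0 := fun x => by rw [Nat.cast_smul_eq_nsmul, hN]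
      have noeth : IsNoetherian R N :=
        Module.Finite.isNoetherian_of_killed (Ideal.span {(p : R)}) N fun a ha x => by
          obtain ⟨b, rfl⟩ := Ideal.mem_span_singleton'.1 ha
          rw [mul_smul, hN', smul_zero]
      have hkill : ∀ (N' : Type v) [AddCommGroup N'] [Module R N'] [Module.Finite R N'],
          (∀ x : N', (p : R) • x = 0) → (∀ x : N', T • x = 0) → Finite N' := by
        intro N' _ _ _ h1 h2
        refine Module.Finite.finite_of_killed (Ideal.span {(p : R), T}) N' fun a ha x => ?_
        obtain ⟨b, c, rfl⟩ := Ideal.mem_span_pair.1 ha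
        rw [add_smul, mul_smul, mul_smul, h1, h2, smul_zero, smul_zero, add_zero]
      have f1 : Finite (ker (lsmul R N T)) :=
        hkill _ (fun x => Subtype.ext (hN' x)) fun x => Subtype.ext x.2
      have f2 : Finite (N ⧸ range (lsmul R N T)) := by
        refine hkill _ (fun x => ?_) fun x => ?_
        · obtain ⟨x, rfl⟩ := Submodule.mkQ_surjective _ x
          rw [← map_smul, hN', map_zero]
        · obtain ⟨x, rfl⟩ := Submodule.mkQ_surjective _ x
          rw [← map_smul]
          exact (Submodule.Quotient.mk_eq_zero _).2 ⟨x, rfl⟩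
      refine ⟨noeth, Nat.card (ker (lsmul R N T)), Nat.card (N ⧸ range (lsmul R N T)),
        Nat.card_pos, Nat.card_pos, fun m => ?_⟩
      have : lsmul R N (omegaElement p T m) = lsmul R N T ^ p ^ m := by
        obtain ⟨r, hr⟩ := omegaElement_eq_pow_add p T m
        have hpow : ∀ n, lsmul R N T ^ n = lsmul R N (T ^ n) := fun n => by
          induction n with
          | zero => ext x; simp
          | succ n ih => ext x; rw [pow_succ', ih, pow_succ']; exact (mul_smul T (T ^ n) x).symm
        ext x
        rw [hr, hpow, lsmul_apply, lsmul_apply, add_smul, mul_smul, hN', add_zero]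
      rw [this]
      exact card_ker_mul_card_coker_pow _ _
    -- Dévissage along 0 → pM → M → M/pM → 0, where pM is killed by p^k.
    let M' : Submodule R M := range (lsmul R M (p : R))
    have hM' : ∀ x : M', p ^ k • x = 0 := by
      rintro ⟨_, x, rfl⟩
      refine Subtype.ext ?_
      change p ^ k • ((p : R) • x) = 0
      rw [Nat.cast_smul_eq_nsmul, ← mul_nsmul', ← pow_succ, hM]
    have hM'' : ∀ x : M ⧸ M', p • x = 0 := by
      intro x
      obtain ⟨x, rfl⟩ := Submodule.mkQ_surjective _ x
      rw [← map_nsmul, ← Nat.cast_smul_eq_nsmul R]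
      exact (Submodule.Quotient.mk_eq_zero _).2 ⟨x, rfl⟩
    have : Module.Finite R M' := Module.Finite.range _
    obtain ⟨n₁, c₁, d₁, hc₁, hd₁, h₁⟩ := ih M' hM'
    obtain ⟨n₂, c₂, d₂, hc₂, hd₂, h₂⟩ := key (M ⧸ M') hM''
    refine ⟨isNoetherian_of_range_eq_ker M'.subtype M'.mkQ (by simp), c₁ * c₂, d₁ * d₂,
      Nat.mul_pos hc₁ hc₂, Nat.mul_pos hd₁ hd₂, fun m => ?_⟩
    obtain ⟨a₁, a₂, a₃⟩ := h₁ m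
    obtain ⟨b₁, b₂, b₃⟩ := h₂ m
    obtain ⟨e₁, e₂, e₃⟩ := card_ker_mul_card_coker_of_exact (i := M'.subtype) (q := M'.mkQ)
      (f := lsmul R M (omegaElement p T m)) M'.injective_subtype
      (LinearMap.exact_subtype_mkQ M') M'.mkQ_surjective
      (f' := lsmul R M' (omegaElement p T m)) (f'' := lsmul R (M ⧸ M') (omegaElement p T m)) rfl rfl
    refine ⟨e₁, e₂, ?_⟩
    have p₁ : 0 < Nat.card (ker (lsmul R M' (omegaElement p T m))) := Nat.card_pos
    have p₂ : 0 < Nat.card (ker (lsmul R (M ⧸ M') (omegaElement p T m))) := Nat.card_pos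
    apply Nat.eq_of_mul_eq_mul_left (Nat.mul_pos p₁ p₂)
    rw [← mul_assoc, e₃, mul_pow, mul_pow]
    linear_combination (Nat.card (ker (lsmul R M (omegaElement p T m))) : ℕ) *
      (Nat.card ((M ⧸ M') ⧸ range (lsmul R (M ⧸ M') (omegaElement p T m))) * c₂ ^ p ^ m * a₃ +
       Nat.card (ker (lsmul R M' (omegaElement p T m))) * d₁ ^ p ^ m * b₃)

open LinearMap in
/-- For large `m`, the kernel of `(1 + T) ^ (p ^ m) - 1` has constant order `p ^ ν`, and its cokernel
has order `p ^ (μ p ^ m + ν)`. -/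
theorem exists_card_omegaElement_eq (p : ℕ) [hp : Fact p.Prime] (T : R)
    [IsNoetherian R (R ⧸ Ideal.span {(p : R)})] [Finite (R ⧸ Ideal.span {(p : R), T})] (k : ℕ)
    (M : Type v) [AddCommGroup M] [Module R M] [Module.Finite R M] (hM : ∀ x : M, p ^ k • x = 0) :
    ∃ μ ν m₀ : ℕ, ∀ m, m₀ ≤ m →
      Nat.card (ker (lsmul R M (omegaElement p T m))) = p ^ ν ∧
      Nat.card (M ⧸ range (lsmul R M (omegaElement p T m))) = p ^ (μ * p ^ m + ν) := by
  obtain ⟨noeth, c, d, hc, hd, h⟩ := card_ker_omegaElement_mul_pow p T k M hM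
  choose f₁ f₂ h using h
  have ha : ∀ m, ∃ a, Nat.card (M ⧸ range (lsmul R M (omegaElement p T m))) = p ^ a := fun m =>
    Nat.card_eq_prime_pow_of_killed hp.out k fun x => by
      obtain ⟨x, rfl⟩ := Submodule.mkQ_surjective _ x
      rw [← map_nsmul, hM, map_zero]
  have hb : ∀ m, ∃ b, Nat.card (ker (lsmul R M (omegaElement p T m))) = p ^ b := fun m =>
    Nat.card_eq_prime_pow_of_killed hp.out k fun x => Subtype.ext (hM x)
  choose a ha using ha
  choose b hb using hb
  have hp1 := hp.out.one_lt
  -- Comparison with the case m = 0 eliminates c and d, since d/c = p^(a 0 - b 0).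
  have hab : ∀ m, a m + b 0 * p ^ m = b m + a 0 * p ^ m := by
    intro m
    have h0 := h 0
    have hm := h m
    rw [ha, hb] at h0 hm
    rw [pow_zero, pow_one, pow_one] at h0
    apply Nat.pow_right_injective hp1
    change p ^ (a m + b 0 * p ^ m) = p ^ (b m + a 0 * p ^ m)
    rw [pow_add, pow_add, pow_mul, pow_mul]
    apply Nat.eq_of_mul_eq_mul_right (Nat.pow_pos (n := p ^ m) hc)
    calc _ = (p ^ a m * c ^ p ^ m) * (p ^ b 0) ^ p ^ m := by ring
      _ = p ^ b m * (p ^ b 0 * d) ^ p ^ m := by rw [hm, mul_pow]; ring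
      _ = _ := by rw [← h0, mul_pow]; ring
  have hmono : Monotone fun m => ker (lsmul R M (omegaElement p T m)) := by
    refine monotone_nat_of_le_succ fun m x hx => ?_
    obtain ⟨r, hr⟩ := omegaElement_dvd_succ p T m
    rw [mem_ker, lsmul_apply] at hx ⊢
    rw [hr, mul_comm, mul_smul, hx, smul_zero]
  obtain ⟨m₀, hm₀⟩ := monotone_stabilizes_iff_noetherian.2 noeth ⟨_, hmono⟩
  have hbm : ∀ m, m₀ ≤ m → b m = b m₀ := by
    intro m hm
    have h1 : ker (lsmul R M (omegaElement p T m₀)) = ker (lsmul R M (omegaElement p T m)) :=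
      hm₀ m hm
    apply Nat.pow_right_injective hp1
    change p ^ b m = p ^ b m₀
    rw [← hb, ← hb, h1]
  -- Otherwise a n ≤ b m₀ - p^n once n ≥ m₀, which is negative when n exceeds b m₀.
  have hle : b 0 ≤ a 0 := by
    by_contra hlt
    set n := m₀ + b m₀ + 1
    have h1 := hab n
    rw [hbm n (by omega)] at h1
    have h2 : n < p ^ n := Nat.lt_pow_self hp1
    have h3 : (a 0 + 1) * p ^ n ≤ b 0 * p ^ n := Nat.mul_le_mul_right _ (by omega)
    rw [add_mul, one_mul] at h3
    omega
  refine ⟨a 0 - b 0, b m₀, m₀, fun m hm => ⟨by rw [hb, hbm m hm], ?_⟩⟩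
  rw [ha]
  congr 1
  have h1 := hab m
  rw [hbm m hm] at h1
  have h2 : b 0 * p ^ m ≤ a 0 * p ^ m := Nat.mul_le_mul_right _ hle
  rw [Nat.sub_mul]
  omega

end Algebra

/-! ### Noetherianity modulo p from powers of T -/

section

variable {R : Type*} [CommRing R]

/-- If the elements outside `(p, T)` are units modulo `p` and `⋂ (p, T ^ n) = (p)`, then every ideal
of `R/p` is generated by a power of `T`. -/
theorem isNoetherian_quotient_of_unit_mul_pow (p T : R)
    (hunit : ∀ x : R, (∃ y z, x = p * y + T * z) ∨ ∃ y z, 1 = p * y + x * z)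
    (hcap : ∀ x : R, (∀ n, ∃ y z, x = p * y + T ^ n * z) → ∃ y, x = p * y) :
    IsNoetherian R (R ⧸ Ideal.span {p}) := by
  classical
  -- Take n maximal with x ∈ (p, T^n). The cofactor of T^n is not in (p, T), hence is a unit modulo
  -- p, so x and T^n are associated modulo p.
  have key : ∀ x : R, (¬ ∃ y, x = p * y) →
      ∃ n, (∃ y z, x = p * y + T ^ n * z) ∧ ∃ y z, T ^ n = p * y + x * z := by
    intro x hx
    have hex : ∃ n, ¬ ∃ y z, x = p * y + T ^ n * z := by
      by_contra! h
      exact hx (hcap x h)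
    have h0 : Nat.find hex ≠ 0 := fun h => by
      have := Nat.find_spec hex
      rw [h] at this
      exact this ⟨0, x, by ring⟩
    obtain ⟨n, hn⟩ := Nat.exists_eq_succ_of_ne_zero h0
    have h1 : ¬ ∃ y z, x = p * y + T ^ (n + 1) * z := by
      have := Nat.find_spec hex
      rwa [hn] at this
    have h2 : ∃ y z, x = p * y + T ^ n * z := by
      have := Nat.find_min hex (m := n) (by omega)
      push Not at this
      exact this
    obtain ⟨y, z, hyz⟩ := h2
    refine ⟨n, ⟨y, z, hyz⟩, ?_⟩
    rcases hunit z with ⟨y', z', h⟩ | ⟨y', z', h⟩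
    · exact absurd ⟨y + T ^ n * y', z', by rw [hyz, h]; ring⟩ h1
    · refine ⟨T ^ n * y' - y * z', z', ?_⟩
      calc T ^ n = T ^ n * 1 := (mul_one _).symm
        _ = _ := by rw [h, hyz]; ring
  have hmk : ∀ y z : R, (Submodule.Quotient.mk (p * y + z) : R ⧸ Ideal.span {p}) =
      Submodule.Quotient.mk z := fun y z =>
    (Submodule.Quotient.eq _).2 (by
      rw [add_sub_cancel_right]; exact Ideal.mul_mem_right _ _ (Ideal.mem_span_singleton_self p))
  refine ⟨fun N => ?_⟩
  by_cases hN : ∃ n, (Submodule.Quotient.mk (T ^ n) : R ⧸ Ideal.span {p}) ∈ N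
  · refine ⟨{Submodule.Quotient.mk (T ^ Nat.find hN)}, le_antisymm ?_ ?_⟩
    · rw [Submodule.span_le]
      simpa using Nat.find_spec hN
    · intro x hx
      obtain ⟨x, rfl⟩ := Submodule.Quotient.mk_surjective _ x
      by_cases h : ∃ y, x = p * y
      · obtain ⟨y, rfl⟩ := h
        rw [← add_zero (p * y), hmk, Submodule.Quotient.mk_zero]
        exact zero_mem _
      · obtain ⟨n, ⟨y, z, h1⟩, ⟨y', z', h2⟩⟩ := key x h
        have hn : Submodule.Quotient.mk (T ^ n) ∈ N := by
          rw [h2, hmk, mul_comm]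
          exact N.smul_mem z' hx
        rw [h1, hmk, ← Nat.sub_add_cancel (Nat.find_min' hN hn), pow_add, mul_right_comm]
        rw [Finset.coe_singleton, Submodule.mem_span_singleton]
        exact ⟨T ^ (n - Nat.find hN) * z, rfl⟩
  · refine ⟨∅, ?_⟩
    rw [Finset.coe_empty, Submodule.span_empty, eq_comm, Submodule.eq_bot_iff]
    intro x hx
    obtain ⟨x, rfl⟩ := Submodule.Quotient.mk_surjective _ x
    by_cases h : ∃ y, x = p * y
    · obtain ⟨y, rfl⟩ := h
      rw [← add_zero (p * y), hmk, Submodule.Quotient.mk_zero]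
    · obtain ⟨n, -, ⟨y', z', h2⟩⟩ := key x h
      refine absurd ⟨n, ?_⟩ hN
      rw [h2, hmk, mul_comm]
      exact N.smul_mem z' hx

end

/-! ### The completed group algebra of a procyclic group -/

namespace completedGroupAlgebra

variable {p : ℕ} [hp : Fact p.Prime] {G : Type u} [Group G] [TopologicalSpace G]

theorem DvdModulo.exists_eq_mul [IsTopologicalGroup G] [CompactSpace G] {c : ℕ}
    {x : completedGroupAlgebra p G} (hx : DvdModulo ⊥ c x) : ∃ y, x = c * y := by
  obtain ⟨y, z, h⟩ := hx.exists_eq (t := 1) inferInstance fun U g hg => ⟨0, by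
    rw [Subgroup.mem_bot.1 hg]; simp⟩
  exact ⟨y, by rw [h, map_one, sub_self, zero_mul, add_zero]⟩

variable (G) in
/-- The whole group, as an open normal subgroup. -/
def topOpenNormal : OpenNormalSubgroup G :=
  { toOpenSubgroup := ⊤, isNormal' := Subgroup.normal_top }

/-- The only level containing ⊤ is G itself, and there the augmentation identifies ℤ_p[G/G] with
ℤ_p. -/
theorem dvdModulo_top_of_dvd_augmentation {c : ℕ} {x : completedGroupAlgebra p G}
    (hx : (c : ℤ_[p]) ∣ augmentation p G x) : DvdModulo ⊤ c x := by
  intro U hU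
  have hVU : (topOpenNormal G).toSubgroup ≤ U.toSubgroup := hU
  rw [← transition_val x hVU]
  have key : ∀ y : MonoidAlgebra ℤ_[p] (G ⧸ (⊤ : Subgroup G)),
      y = MonoidAlgebra.single 1 (MonoidAlgebra.lift ℤ_[p] ℤ_[p] (G ⧸ (⊤ : Subgroup G)) 1 y) := by
    intro y
    induction y using MonoidAlgebra.induction_linear with
    | zero => simp
    | add a b ha hb => rw [map_add, MonoidAlgebra.single_add, ← ha, ← hb]
    | single a r =>
      have : Subsingleton (G ⧸ (⊤ : Subgroup G)) := QuotientGroup.subsingleton_quotient_top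
      rw [Subsingleton.elim a 1]
      simp
  have key' : ∀ y : MonoidAlgebra ℤ_[p] (G ⧸ (⊤ : Subgroup G)),
      (c : ℤ_[p]) ∣ MonoidAlgebra.lift ℤ_[p] ℤ_[p] (G ⧸ (⊤ : Subgroup G)) 1 y →
      (c : MonoidAlgebra ℤ_[p] (G ⧸ (⊤ : Subgroup G))) ∣ y := by
    rintro y ⟨d, hd⟩
    refine ⟨MonoidAlgebra.single 1 d, (key y).trans ?_⟩
    rw [hd, ← nsmul_eq_mul, ← nsmul_eq_mul]
    exact map_nsmul (MonoidAlgebra.singleAddHom (1 : G ⧸ (⊤ : Subgroup G))) c d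
  have h := map_dvd (transition p hVU) (key' (x.1 (topOpenNormal G)) hx)
  exact (map_natCast (transition p hVU) c) ▸ h

theorem augmentation_of (g : G) : augmentation p G (of p g) = 1 := by
  change MonoidAlgebra.lift ℤ_[p] ℤ_[p] (G ⧸ (⊤ : Subgroup G)) 1 (MonoidAlgebra.single _ 1) = 1
  simp

/-- The completed group algebra of a commutative group is a commutative ring. -/
@[reducible]
noncomputable def commRing (hcomm : ∀ a b : G, a * b = b * a) : CommRing (completedGroupAlgebra p G) :=
  { (inferInstance : Ring (completedGroupAlgebra p G)) with
    mul_comm := fun x y => by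
      refine Subtype.ext (funext fun U => ?_)
      let _ : CommMonoid (G ⧸ U.toSubgroup) :=
        { (inferInstance : Group (G ⧸ U.toSubgroup)) with
          mul_comm := fun a b => by
            obtain ⟨a, rfl⟩ := QuotientGroup.mk_surjective a
            obtain ⟨b, rfl⟩ := QuotientGroup.mk_surjective b
            exact congrArg _ (hcomm a b) }
      exact mul_comm (x.1 U) (y.1 U) }

theorem omegaElement_of (hcomm : ∀ a b : G, a * b = b * a) (t : G) (m : ℕ) :
    letI := commRing (p := p) hcomm
    omegaElement p (of p t - 1) m = of p (t ^ p ^ m) - 1 := by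
  let := commRing (p := p) hcomm
  change (1 + (of p t - 1)) ^ p ^ m - 1 = of p (t ^ p ^ m) - 1
  rw [add_sub_cancel, map_pow]

section Procyclic

variable [IsTopologicalGroup G] [CompactSpace G] {t : G}

/-- This is `DvdModulo.exists_eq` for N = G. It is used with c = 0, for the augmentation ideal, and
with c = p, for the ideal (p, t - 1). -/
theorem exists_eq_of_dvd_augmentation
    (hgen : ∀ (U : OpenNormalSubgroup G) (g : G), ∃ n : ℕ, g * (t ^ n)⁻¹ ∈ U.toSubgroup) {c : ℕ}
    {x : completedGroupAlgebra p G} (hx : (c : ℤ_[p]) ∣ augmentation p G x) :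
    ∃ y z, x = c * y + (of p t - 1) * z :=
  (dvdModulo_top_of_dvd_augmentation hx).exists_eq Subgroup.normal_top fun U g _ => hgen U g

/-- Every finite level kills some t^(p^m) - 1, so the ideals (c, t^(p^m) - 1) intersect in (c). -/
theorem exists_eq_natCast_mul_of_forall
    (hpow : ∀ U : OpenNormalSubgroup G, ∃ n : ℕ, t ^ p ^ n ∈ U.toSubgroup) {c : ℕ}
    {x : completedGroupAlgebra p G} (hx : ∀ m : ℕ, ∃ y z, x = c * y + (of p (t ^ p ^ m) - 1) * z) :
    ∃ y, x = c * y := by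
  refine DvdModulo.exists_eq_mul fun U _ => ?_
  obtain ⟨m, hm⟩ := hpow U
  obtain ⟨y, z, h⟩ := hx m
  exact dvdModulo_of_eq hm h U le_rfl

/-- If `p` does not divide the augmentation of `x`, then `x` is a unit modulo `p`. -/
theorem exists_one_eq_of_not_dvd_augmentation (hcomm : ∀ a b : G, a * b = b * a)
    (hgen : ∀ (U : OpenNormalSubgroup G) (g : G), ∃ n : ℕ, g * (t ^ n)⁻¹ ∈ U.toSubgroup)
    (hpow : ∀ U : OpenNormalSubgroup G, ∃ n : ℕ, t ^ p ^ n ∈ U.toSubgroup)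
    {x : completedGroupAlgebra p G} (hx : ¬ (p : ℤ_[p]) ∣ augmentation p G x) :
    ∃ y z, 1 = p * y + x * z := by
  have hdvd : ∀ a : ℤ_[p], (p : ℤ_[p]) ∣ a ↔ PadicInt.toZMod a = 0 := fun a => by
    rw [← RingHom.mem_ker, PadicInt.ker_toZMod, PadicInt.maximalIdeal_eq_span_p,
      Ideal.mem_span_singleton]
  rw [hdvd] at hx
  -- The integer n inverts the augmentation of x modulo p, so 1 - nx lies in (p, t - 1).
  set n := (PadicInt.toZMod (augmentation p G x))⁻¹.val
  have h1 : (p : ℤ_[p]) ∣ augmentation p G (1 - n * x) := by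
    rw [hdvd, map_sub, map_mul, map_one, map_natCast, map_sub, map_mul, map_one, map_natCast,
      ZMod.natCast_val, ZMod.cast_id', id_eq, inv_mul_cancel₀ hx, sub_self]
  obtain ⟨w, y, hwy⟩ := exists_eq_of_dvd_augmentation hgen h1
  refine exists_eq_mul_add_mul _ _ _ fun U => ?_
  obtain ⟨m, hm⟩ := hpow U
  let := commRing (p := p) hcomm
  have hom := omegaElement_of (p := p) hcomm t m
  set T : completedGroupAlgebra p G := of p t - 1
  have hwy' : (1 : completedGroupAlgebra p G) - n * x = p * w + T * y := hwy
  obtain ⟨r, hr⟩ := omegaElement_eq_pow_add p T m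
  -- A finite geometric series suffices at level U: (Ty)^(p^m) lies in (p, t^(p^m) - 1), and t^(p^m)
  -- becomes 1 there.
  have hgeom : (1 - T * y) * ∑ i ∈ Finset.range (p ^ m), (T * y) ^ i = 1 - (T * y) ^ p ^ m :=
    mul_neg_geom_sum _ _
  set S := ∑ i ∈ Finset.range (p ^ m), (T * y) ^ i
  have hfin : ∃ a b c, (1 : completedGroupAlgebra p G) = p * a + x * b + omegaElement p T m * c := by
    refine ⟨w * S - r * y ^ p ^ m, n * S, y ^ p ^ m, ?_⟩
    rw [hr]
    rw [mul_pow] at hgeom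
    linear_combination S * hwy' - hgeom
  obtain ⟨a, b, c, habc⟩ := hfin
  rw [hom] at habc
  refine ⟨a.1 U, b.1 U, ?_⟩
  have : (1 : completedGroupAlgebra p G).1 U =
      p * a.1 U + x.1 U * b.1 U + ((of p (t ^ p ^ m)).1 U - 1) * c.1 U :=
    congrArg (fun w => w.1 U) habc
  rw [of_val_of_mem p hm, sub_self, zero_mul, add_zero] at this
  exact this

theorem isNoetherian_quotient_span_prime (hcomm : ∀ a b : G, a * b = b * a)
    (hgen : ∀ (U : OpenNormalSubgroup G) (g : G), ∃ n : ℕ, g * (t ^ n)⁻¹ ∈ U.toSubgroup)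
    (hpow : ∀ U : OpenNormalSubgroup G, ∃ n : ℕ, t ^ p ^ n ∈ U.toSubgroup) :
    letI := commRing (p := p) hcomm
    IsNoetherian (completedGroupAlgebra p G)
      (completedGroupAlgebra p G ⧸ Ideal.span {(p : completedGroupAlgebra p G)}) := by
  let := commRing (p := p) hcomm
  refine isNoetherian_quotient_of_unit_mul_pow _ (of p t - 1) (fun x => ?_) fun x hx => ?_
  · by_cases h : (p : ℤ_[p]) ∣ augmentation p G x
    · exact Or.inl (exists_eq_of_dvd_augmentation hgen h)
    · exact Or.inr (exists_one_eq_of_not_dvd_augmentation hcomm hgen hpow h)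
  · refine exists_eq_natCast_mul_of_forall hpow fun m => ?_
    obtain ⟨y, z, h⟩ := hx (p ^ m)
    obtain ⟨r, hr⟩ := omegaElement_eq_pow_add p (of p t - 1 : completedGroupAlgebra p G) m
    rw [omegaElement_of hcomm] at hr
    refine ⟨y - r * z, z, ?_⟩
    change x = (p : completedGroupAlgebra p G) * (y - r * z) + (of p (t ^ p ^ m) - 1) * z
    rw [hr, h]
    ring

/-- The augmentation modulo p has kernel (p, t - 1), so the quotient embeds in 𝔽_p. -/
theorem finite_quotient_span_pair (hcomm : ∀ a b : G, a * b = b * a)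
    (hgen : ∀ (U : OpenNormalSubgroup G) (g : G), ∃ n : ℕ, g * (t ^ n)⁻¹ ∈ U.toSubgroup) :
    letI := commRing (p := p) hcomm
    Finite (completedGroupAlgebra p G ⧸
      Ideal.span {(p : completedGroupAlgebra p G), of p t - 1}) := by
  let := commRing (p := p) hcomm
  let ε : completedGroupAlgebra p G →+* ZMod p := PadicInt.toZMod.comp (augmentation p G)
  have h : ∀ x y, ε x = ε y → (Submodule.Quotient.mk x : completedGroupAlgebra p G ⧸
      Ideal.span {(p : completedGroupAlgebra p G), of p t - 1}) = Submodule.Quotient.mk y := by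
    intro x y hxy
    rw [Submodule.Quotient.eq]
    have h1 : (p : ℤ_[p]) ∣ augmentation p G (x - y) := by
      rw [← Ideal.mem_span_singleton, ← PadicInt.maximalIdeal_eq_span_p, ← PadicInt.ker_toZMod,
        RingHom.mem_ker]
      exact (map_sub ε x y).trans (sub_eq_zero.2 hxy)
    obtain ⟨a, b, hab⟩ := exists_eq_of_dvd_augmentation hgen h1
    exact Ideal.mem_span_pair.2 ⟨a, b, by rw [mul_comm a, mul_comm b]; exact hab.symm⟩
  refine Finite.of_injective (β := ZMod p) (fun q => ε (Submodule.Quotient.mk_surjective _ q).choose)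
    fun q q' hq => ?_
  rw [← (Submodule.Quotient.mk_surjective _ q).choose_spec, h _ _ hq,
    (Submodule.Quotient.mk_surjective _ q').choose_spec]

end Procyclic

end completedGroupAlgebra

/-! ### Continuous images of ℤ_p, open normal subgroups and the subgroups H^n -/

section Procyclic

variable {p : ℕ} [hp : Fact p.Prime]

theorem PadicInt.exists_pow_mul_mem_of_continuous {K : Type*} [Group K] [TopologicalSpace K]
    (f : Multiplicative ℤ_[p] →* K) (hf : Continuous f) {U : Set K} (hU : IsOpen U) (h1 : 1 ∈ U) :
    ∃ k : ℕ, ∀ z : ℤ_[p], f (Multiplicative.ofAdd (p ^ k * z)) ∈ U := by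
  have ho : IsOpen ((fun z : ℤ_[p] => f (Multiplicative.ofAdd z)) ⁻¹' U) :=
    hU.preimage (hf.comp continuous_ofAdd)
  obtain ⟨ε, hε, hball⟩ := Metric.isOpen_iff.1 ho 0 (by
    change f 1 ∈ U
    rwa [map_one])
  obtain ⟨k, hk⟩ := PadicInt.exists_pow_neg_lt p hε
  refine ⟨k, fun z => hball ?_⟩
  rw [mem_ball_zero_iff]
  refine lt_of_le_of_lt ?_ hk
  rw [PadicInt.norm_le_pow_iff_mem_span_pow]
  exact Ideal.mul_mem_right _ _ (Ideal.mem_span_singleton_self _)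

/-- The image of `1` under a continuous homomorphism from `ℤ_p` topologically generates the image. -/
theorem PadicInt.exists_mul_inv_pow_mem_of_continuous {K : Type*} [Group K] [TopologicalSpace K]
    (f : Multiplicative ℤ_[p] →* K) (hf : Continuous f) (U : OpenNormalSubgroup K)
    (z : Multiplicative ℤ_[p]) :
    ∃ n : ℕ, f z * (f (Multiplicative.ofAdd 1) ^ n)⁻¹ ∈ U.toSubgroup := by
  obtain ⟨k, hk⟩ := exists_pow_mul_mem_of_continuous f hf U.isOpen' U.toSubgroup.one_mem
  obtain ⟨w, hw⟩ := Ideal.mem_span_singleton.1 (PadicInt.appr_spec k z.toAdd)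
  refine ⟨z.toAdd.appr k, ?_⟩
  rw [← map_pow, ← map_inv, ← map_mul]
  convert hk w using 2
  rw [← hw, ofAdd_sub, div_eq_mul_inv, ← ofAdd_nsmul, nsmul_one]
  rfl

theorem PadicInt.exists_pow_prime_pow_mem_of_continuous {K : Type*} [Group K] [TopologicalSpace K]
    (f : Multiplicative ℤ_[p] →* K) (hf : Continuous f) (U : OpenNormalSubgroup K)
    (z : Multiplicative ℤ_[p]) : ∃ n : ℕ, f z ^ p ^ n ∈ U.toSubgroup := by
  obtain ⟨k, hk⟩ := exists_pow_mul_mem_of_continuous f hf U.isOpen' U.toSubgroup.one_mem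
  refine ⟨k, ?_⟩
  have h : z ^ p ^ k = Multiplicative.ofAdd ((p : ℤ_[p]) ^ k * z.toAdd) := by
    rw [← Nat.cast_pow, ← nsmul_eq_mul, ofAdd_nsmul, ofAdd_toAdd]
  rw [← map_pow, h]
  exact hk z.toAdd

theorem PadicInt.pow_ne_one_of_injective {K : Type*} [Group K] {f : Multiplicative ℤ_[p] →* K}
    (hf : Function.Injective f) {j : ℕ} (hj : j ≠ 0) : f (Multiplicative.ofAdd 1) ^ j ≠ 1 := by
  rw [← map_pow, ← ofAdd_nsmul, nsmul_one]
  intro h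
  have h1 : Multiplicative.ofAdd (j : ℤ_[p]) = 1 := hf (h.trans (map_one f).symm)
  have h2 : (j : ℤ_[p]) = 0 := Multiplicative.ofAdd.injective h1
  exact hj (Nat.cast_eq_zero.1 h2)

end Procyclic

section Profinite

variable {G : Type*} [Group G] [TopologicalSpace G] [IsTopologicalGroup G] [CompactSpace G]
  [TotallyDisconnectedSpace G]

/-- Some open normal W misses the closed coset sN, which does not contain 1; then s is not in WN. -/
theorem exists_openNormalSubgroup_ge_notMem {N : Subgroup G} (hN : N.Normal)
    (hcl : IsClosed (N : Set G)) {s : G} (hs : s ∉ N) :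
    ∃ V : OpenNormalSubgroup G, N ≤ V.toSubgroup ∧ s ∉ V.toSubgroup := by
  have ho : IsOpen {x : G | s⁻¹ * x ∉ N} :=
    (hcl.preimage (continuous_const_mul s⁻¹)).isOpen_compl
  obtain ⟨W, hW⟩ := ProfiniteGrp.exist_openNormalSubgroup_sub_open_nhds_of_one ho (by
    change s⁻¹ * 1 ∉ N
    rwa [mul_one, inv_mem_iff])
  refine ⟨{ toSubgroup := W.toSubgroup ⊔ N
            isOpen' := Subgroup.isOpen_mono le_sup_left W.isOpen'
            isNormal' := Subgroup.sup_normal _ _ }, le_sup_right, fun h => ?_⟩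
  obtain ⟨w, hw, n, hn, hwn⟩ := Subgroup.mem_sup_of_normal_right.1 h
  refine hW hw ?_
  rw [← hwn, mul_inv_rev, inv_mul_cancel_right]
  exact inv_mem hn

/-- If no power of `t` lies in the closed normal subgroup `N`, then the order of `t` grows without
bound in the finite quotients of `G/N`. -/
theorem exists_orderOf_dvd_orderOf {p : ℕ} [hp : Fact p.Prime] {N : Subgroup G} (hN : N.Normal)
    (hcl : IsClosed (N : Set G)) {t : G} (htN : ∀ j : ℕ, j ≠ 0 → t ^ j ∉ N)
    (htp : ∀ U : OpenNormalSubgroup G, ∃ n : ℕ, t ^ p ^ n ∈ U.toSubgroup) (k : ℕ)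
    (U : OpenNormalSubgroup G) (hU : N ≤ U.toSubgroup) :
    ∃ V : OpenNormalSubgroup G, N ≤ V.toSubgroup ∧ V.toSubgroup ≤ U.toSubgroup ∧
      p ^ k * orderOf (t : G ⧸ U.toSubgroup) ∣ orderOf (t : G ⧸ V.toSubgroup) := by
  have hord : ∀ U : OpenNormalSubgroup G, ∃ a, orderOf (t : G ⧸ U.toSubgroup) = p ^ a := by
    intro U
    obtain ⟨n, hn⟩ := htp U
    have h1 : (t : G ⧸ U.toSubgroup) ^ p ^ n = 1 := (QuotientGroup.eq_one_iff _).2 hn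
    obtain ⟨a, -, ha⟩ := (Nat.dvd_prime_pow hp.out).1 (orderOf_dvd_of_pow_eq_one h1)
    exact ⟨a, ha⟩
  obtain ⟨a, ha⟩ := hord U
  -- At V₀ the power t^(p^(k+a)) survives, so the p-power order of t exceeds p^(k+a); intersecting
  -- with U can only enlarge it.
  obtain ⟨V₀, hNV, hV⟩ := exists_openNormalSubgroup_ge_notMem hN hcl
    (htN (p ^ (k + a)) (pow_ne_zero _ hp.out.ne_zero))
  refine ⟨V₀ ⊓ U, le_inf hNV hU, inf_le_right, ?_⟩
  obtain ⟨b, hb⟩ := hord (V₀ ⊓ U)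
  rw [ha, hb, ← pow_add]
  refine pow_dvd_pow _ ?_
  by_contra! hlt
  refine hV ?_
  have h1 : (t : G ⧸ (V₀ ⊓ U).toSubgroup) ^ p ^ (k + a) = 1 := by
    rw [← orderOf_dvd_iff_pow_eq_one, hb]
    exact pow_dvd_pow _ hlt.le
  have h2 : t ^ p ^ (k + a) ∈ (V₀ ⊓ U).toSubgroup := (QuotientGroup.eq_one_iff _).1 h1
  exact h2.1

end Profinite

section SubgroupPow

variable {p : ℕ} [hp : Fact p.Prime] {G : Type u} [Group G]
  {H : Subgroup G} {f : Multiplicative ℤ_[p] →* G}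

/-- Since the source is commutative, the n-th powers already form a subgroup, so taking the closure
adds nothing. -/
theorem range_comp_powMonoidHom_eq_subgroupPow (hf : f.range = H) (n : ℕ) :
    (f.comp (powMonoidHom n)).range = subgroupPow H n := by
  subst hf
  refine le_antisymm ?_ ?_
  · rintro _ ⟨z, rfl⟩
    exact Subgroup.subset_closure ⟨f z, ⟨z, rfl⟩, map_pow f z n⟩
  · rw [subgroupPow, Subgroup.closure_le]
    rintro _ ⟨_, ⟨z, rfl⟩, rfl⟩
    exact ⟨z, map_pow f z n⟩

theorem subgroupPow_normal (hH : H.Normal) (n : ℕ) : (subgroupPow H n).Normal := by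
  refine ⟨fun x hx g => ?_⟩
  have hle : subgroupPow H n ≤ (subgroupPow H n).comap (MulAut.conj g).toMonoidHom := by
    conv_lhs => rw [subgroupPow]
    rw [Subgroup.closure_le]
    rintro _ ⟨h, hh, rfl⟩
    exact Subgroup.subset_closure
      ⟨g * h * g⁻¹, hH.conj_mem h hh g, (map_pow (MulAut.conj g) h n)⟩
  exact hle hx

theorem subgroupPow_le (H : Subgroup G) (n : ℕ) : subgroupPow H n ≤ H := by
  rw [subgroupPow, Subgroup.closure_le]
  rintro _ ⟨h, hh, rfl⟩
  exact pow_mem hh n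

end SubgroupPow

/-! ### Augmentation submodules and elementary modules -/

namespace completedGroupAlgebra

variable {p : ℕ} [hp : Fact p.Prime] {G : Type u} [Group G] [TopologicalSpace G]

/-- As p is central, left multiples can be written as right multiples, the form in which `DvdModulo`
delivers them. -/
theorem mem_span_natCast_pow_iff (k : ℕ) (x : completedGroupAlgebra p G) :
    x ∈ Submodule.span (completedGroupAlgebra p G) {(p : completedGroupAlgebra p G) ^ k} ↔
      ∃ y, x = (p ^ k : ℕ) * y := by
  rw [Submodule.mem_span_singleton]
  constructor
  · rintro ⟨a, rfl⟩
    exact ⟨a, by rw [smul_eq_mul, Nat.cast_comm, Nat.cast_pow]⟩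
  · rintro ⟨y, rfl⟩
    exact ⟨y, by rw [smul_eq_mul, Nat.cast_comm, Nat.cast_pow]⟩

theorem exists_pow_nsmul_elementaryModule_eq_zero {s : ℕ} (k : Fin s → ℕ) :
    ∃ K : ℕ, ∀ e : ElementaryModule p G k, p ^ K • e = 0 := by
  refine ⟨∑ i, k i, fun e => DFinsupp.ext fun i => ?_⟩
  obtain ⟨x, hx⟩ := Submodule.Quotient.mk_surjective _ (e i)
  change p ^ (∑ i, k i) • e i = 0
  rw [← hx, ← Submodule.Quotient.mk_smul, Submodule.Quotient.mk_eq_zero,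
    mem_span_natCast_pow_iff, ← Finset.sum_erase_add _ _ (Finset.mem_univ i)]
  exact ⟨p ^ (∑ j ∈ Finset.univ.erase i, k j) • x, by
    rw [← nsmul_eq_mul, smul_smul, ← pow_add, add_comm]⟩

variable [IsTopologicalGroup G] [CompactSpace G]

/-- `I_N X` consists of the multiples of `t - 1`, if `t` topologically generates the closed normal
subgroup `N`. -/
theorem mem_augmentationSubmodule_iff {N : Subgroup G} (hN : N.Normal) (hcl : IsClosed (N : Set G))
    {t : G} (ht : t ∈ N)
    (hgen : ∀ (U : OpenNormalSubgroup N) (g : N), ∃ n : ℕ, g * ((⟨t, ht⟩ : N) ^ n)⁻¹ ∈ U.toSubgroup)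
    (X : Type v) [AddCommGroup X] [Module (completedGroupAlgebra p G) X] (y : X) :
    y ∈ augmentationSubmodule p N X ↔ ∃ x, y = (of p t - 1) • x := by
  have hgen' : ∀ (U : OpenNormalSubgroup G), ∀ g ∈ N, ∃ n : ℕ, g * (t ^ n)⁻¹ ∈ U.toSubgroup :=
    fun U g hg => hgen (comapOpenNormal ⟨N.subtype, continuous_subtype_val⟩ U) ⟨g, hg⟩
  have hmap : ofSubgroup p N (of p ⟨t, ht⟩ - 1) = of p t - 1 := by
    rw [map_sub, map_one, ofSubgroup_of]
  have hcomp : CompactSpace N := isCompact_iff_compactSpace.1 hcl.isCompact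
  constructor
  · intro hy
    let S : Submodule (completedGroupAlgebra p G) X :=
      { carrier := {y | ∃ x, y = (of p t - 1) • x}
        zero_mem' := ⟨0, by rw [smul_zero]⟩
        add_mem' := by
          rintro _ _ ⟨x, rfl⟩ ⟨x', rfl⟩
          exact ⟨x + x', by rw [smul_add]⟩
        smul_mem' := by
          rintro a _ ⟨x, rfl⟩
          -- Normality of N enters here: a(t - 1) vanishes modulo N, so the case c = 0 rewrites it
          -- as (t - 1)z.
          have h : DvdModulo N 0 (a * (of p t - 1)) := by
            intro U hU
            change _ ∣ a.1 U * ((of p t).1 U - 1)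
            rw [of_val_of_mem p (hU ht), sub_self, mul_zero]
            exact dvd_zero _
          obtain ⟨_, z, hz⟩ := h.exists_eq hN hgen'
          exact ⟨z • x, by rw [smul_smul, hz, Nat.cast_zero, zero_mul, zero_add, mul_smul]⟩ }
    have hS : augmentationSubmodule p N X ≤ S := by
      rw [augmentationSubmodule, Submodule.span_le]
      rintro _ ⟨a, ha, x, rfl⟩
      obtain ⟨_, z, hz⟩ := exists_eq_of_dvd_augmentation (c := 0) hgen (x := a) (by
        rw [RingHom.mem_ker.1 ha]; exact dvd_zero _)
      refine ⟨ofSubgroup p N z • x, ?_⟩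
      rw [hz, Nat.cast_zero, zero_mul, zero_add, map_mul, hmap, mul_smul]
    exact hS hy
  · rintro ⟨x, rfl⟩
    refine Submodule.subset_span ⟨of p ⟨t, ht⟩ - 1, ?_, x, ?_⟩
    · rw [RingHom.mem_ker, map_sub, augmentation_of, map_one, sub_self]
    · rw [hmap]

/-- `t - 1` acts injectively on elementary modules if `t` has infinite order. -/
theorem smul_injective_elementaryModule {t : G}
    (hord : ∀ (k : ℕ) (U : OpenNormalSubgroup G), ⊥ ≤ U.toSubgroup → ∃ V : OpenNormalSubgroup G,
      ⊥ ≤ V.toSubgroup ∧ V.toSubgroup ≤ U.toSubgroup ∧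
      p ^ k * orderOf (t : G ⧸ U.toSubgroup) ∣ orderOf (t : G ⧸ V.toSubgroup))
    {s : ℕ} (k : Fin s → ℕ) (e : ElementaryModule p G k) (he : (of p t - 1) • e = 0) : e = 0 := by
  refine DFinsupp.ext fun i => ?_
  obtain ⟨x, hx⟩ := Submodule.Quotient.mk_surjective _ (e i)
  have h1 : (of p t - 1) • e i = 0 := DFunLike.congr_fun he i
  rw [← hx, ← Submodule.Quotient.mk_smul, Submodule.Quotient.mk_eq_zero,
    mem_span_natCast_pow_iff] at h1
  obtain ⟨y, hy⟩ := h1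
  have h2 : DvdModulo ⊥ (p ^ k i) x := by
    refine DvdModulo.of_sub_one_mul (hord (k i)) ?_
    -- For the trivial subgroup the generator is 1, and the term with 1 - 1 disappears.
    refine dvdModulo_of_eq (t := 1) (y := y) (z := 0) (Subgroup.mem_bot.2 rfl) ?_
    rw [mul_zero, add_zero]
    exact hy
  rw [← hx]
  exact (Submodule.Quotient.mk_eq_zero _).2 ((mem_span_natCast_pow_iff _ _).2 h2.exists_eq_mul)

/-- `g - 1` acts injectively on the coinvariants of an elementary module with respect to `N` if `g`
has infinite order modulo `N`. -/
theorem exists_eq_smul_elementaryModule {N : Subgroup G} (hN : N.Normal) {t : G} (ht : t ∈ N)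
    (hgen : ∀ (U : OpenNormalSubgroup G), ∀ g ∈ N, ∃ n : ℕ, g * (t ^ n)⁻¹ ∈ U.toSubgroup) {g : G}
    (hord : ∀ (k : ℕ) (U : OpenNormalSubgroup G), N ≤ U.toSubgroup → ∃ V : OpenNormalSubgroup G,
      N ≤ V.toSubgroup ∧ V.toSubgroup ≤ U.toSubgroup ∧
      p ^ k * orderOf (g : G ⧸ U.toSubgroup) ∣ orderOf (g : G ⧸ V.toSubgroup))
    {s : ℕ} (k : Fin s → ℕ) (e : ElementaryModule p G k)
    (he : ∃ e', (of p g - 1) • e = (of p t - 1) • e') : ∃ e', e = (of p t - 1) • e' := by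
  classical
  obtain ⟨e', he'⟩ := he
  have key : ∀ i, ∃ c, e i = (of p t - 1) • c := by
    intro i
    obtain ⟨x, hx⟩ := Submodule.Quotient.mk_surjective _ (e i)
    obtain ⟨x', hx'⟩ := Submodule.Quotient.mk_surjective _ (e' i)
    have h1 : (of p g - 1) • e i = (of p t - 1) • e' i := DFunLike.congr_fun he' i
    rw [← hx, ← hx', ← Submodule.Quotient.mk_smul, ← Submodule.Quotient.mk_smul,
      Submodule.Quotient.eq, mem_span_natCast_pow_iff] at h1
    obtain ⟨y, hy⟩ := h1
    -- Modulo N the term with t - 1 vanishes, so (g - 1)x is divisible by p^(k i) there and g - 1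
    -- can be cancelled.
    have h2 : DvdModulo N (p ^ k i) x := by
      refine DvdModulo.of_sub_one_mul (hord (k i)) (dvdModulo_of_eq ht (y := y) (z := x') ?_)
      exact sub_eq_iff_eq_add.1 hy
    obtain ⟨y, z, h⟩ := h2.exists_eq hN hgen
    refine ⟨Submodule.Quotient.mk z, ?_⟩
    rw [← hx, ← Submodule.Quotient.mk_smul, Submodule.Quotient.eq, mem_span_natCast_pow_iff]
    exact ⟨y, by rw [h, smul_eq_mul, add_sub_cancel_right]⟩
  choose c hc using key
  refine ⟨(DFinsupp.equivFunOnFintype (ι := Fin s)).symm c, DFinsupp.ext fun i => ?_⟩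
  rw [hc i]
  rfl

end completedGroupAlgebra

theorem Module.Finite.exists_pow_nsmul_eq_zero {R : Type*} [Ring R] {M : Type*} [AddCommGroup M]
    [Module R M] [Module.Finite R M] {p : ℕ} (h : ∀ x : M, ∃ n : ℕ, p ^ n • x = 0) :
    ∃ k : ℕ, ∀ x : M, p ^ k • x = 0 := by
  classical
  obtain ⟨S, hS⟩ := Module.Finite.fg_top (R := R) (M := M)
  choose n hn using h
  refine ⟨∑ x ∈ S, n x, fun x => ?_⟩
  have hx : x ∈ Submodule.span R (S : Set M) := hS ▸ Submodule.mem_top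
  induction hx using Submodule.span_induction with
  | mem x hx =>
    rw [← Finset.sum_erase_add _ _ (show x ∈ S from hx), pow_add, mul_nsmul', hn, nsmul_zero]
  | zero => rw [nsmul_zero]
  | add x y _ _ hx hy => rw [nsmul_add, hx, hy, add_zero]
  | smul a x _ hx => rw [smul_comm, hx, smul_zero]

/-- A submodule over `S`, viewed as a submodule over `R` by restriction of scalars. -/
def ScalarRestriction.submodule {R : Type u} {S : Type v} [Ring R] [Ring S] (f : R →+* S)
    {M : Type w} [AddCommGroup M] [Module S M] (N : Submodule S M) :
    Submodule R (ScalarRestriction f M) where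
  carrier := N.carrier
  zero_mem' := N.zero_mem
  add_mem' := N.add_mem
  smul_mem' a _ hx := N.smul_mem (f a) hx

/-! ### Counting over Λ(H) and finite submodules of X/TX -/

namespace completedGroupAlgebra

variable {p : ℕ} [hp : Fact p.Prime] {G : Type u} [Group G] [TopologicalSpace G]
  [IsTopologicalGroup G]

/-- The kernel and cokernel of `t ^ (p ^ m) - 1` on a module killed by a power of `p` and finitely
generated over the completed group algebra of the procyclic subgroup generated by `t`. -/
theorem exists_card_smul_eq {H : Subgroup G} [CompactSpace H]
    (hcomm : ∀ a b : H, a * b = b * a) {t : H}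
    (hgen : ∀ (U : OpenNormalSubgroup H) (g : H), ∃ n : ℕ, g * (t ^ n)⁻¹ ∈ U.toSubgroup)
    (hpow : ∀ U : OpenNormalSubgroup H, ∃ n : ℕ, t ^ p ^ n ∈ U.toSubgroup)
    (M : Type v) [AddCommGroup M] [Module (completedGroupAlgebra p G) M]
    (hfin : Module.Finite (completedGroupAlgebra p H) (RestrictTo p H M))
    (hM : ∀ x : M, ∃ n : ℕ, p ^ n • x = 0) :
    ∃ μ ν m₀ : ℕ, ∀ m, m₀ ≤ m →
      Nat.card (DistribSMul.toAddMonoidHom M (of p ((t : G) ^ p ^ m) - 1)).ker = p ^ ν ∧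
      Nat.card (M ⧸ (DistribSMul.toAddMonoidHom M (of p ((t : G) ^ p ^ m) - 1)).range) =
        p ^ (μ * p ^ m + ν) := by
  obtain ⟨k, hk⟩ := Module.Finite.exists_pow_nsmul_eq_zero (R := completedGroupAlgebra p H)
    (M := RestrictTo p H M) hM
  let := commRing (p := p) hcomm
  have h1 := isNoetherian_quotient_span_prime (p := p) hcomm hgen hpow
  have h2 := finite_quotient_span_pair (p := p) hcomm hgen
  obtain ⟨μ, ν, m₀, h⟩ := exists_card_omegaElement_eq p
    (of p t - 1 : completedGroupAlgebra p H) k (RestrictTo p H M) hk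
  refine ⟨μ, ν, m₀, fun m hm => ?_⟩
  obtain ⟨e1, e2⟩ := h m hm
  have hlin : (LinearMap.lsmul (completedGroupAlgebra p H) (RestrictTo p H M)
      (omegaElement p (of p t - 1) m)).toAddMonoidHom =
      DistribSMul.toAddMonoidHom M (of p ((t : G) ^ p ^ m) - 1) := by
    ext x
    change (ofSubgroup p H (omegaElement p (of p t - 1) m) • (show M from x) : M) = _
    rw [omegaElement_of hcomm, map_sub, map_one, ofSubgroup_of]
    rfl
  rw [← hlin]
  exact ⟨e1, e2⟩

end completedGroupAlgebra

section Procyclic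

variable {p : ℕ} [hp : Fact p.Prime] {G : Type u} [Group G] [TopologicalSpace G] {H : Subgroup G}

/-- A continuous homomorphism from `ℤ_p` onto `H` induces one onto `H ^ n`. -/
theorem exists_subgroupPow_surjective {f : Multiplicative ℤ_[p] →* G} (hf : Continuous f)
    (hrange : f.range = H) (n : ℕ) :
    ∃ g : Multiplicative ℤ_[p] →* subgroupPow H n, Continuous g ∧ Function.Surjective g ∧
      ∀ z, (g z : G) = f z ^ n := by
  have hr := range_comp_powMonoidHom_eq_subgroupPow hrange n
  refine ⟨(f.comp (powMonoidHom n)).codRestrict (subgroupPow H n) fun z => hr ▸ ⟨z, rfl⟩,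
    ?_, ?_, fun z => map_pow f z n⟩
  · exact Continuous.subtype_mk (hf.comp (continuous_pow n)) _
  · rintro ⟨x, hx⟩
    rw [← hr] at hx
    obtain ⟨z, hz⟩ := hx
    exact ⟨z, Subtype.ext hz⟩

end Procyclic

/-- The module version of `AddMonoidHom.card_map_comap_range`, for multiplication by an element of a
not necessarily commutative ring. -/
theorem Submodule.card_map_mkQ_comap {R : Type*} [Ring R] {A X E B : Type*} [AddCommGroup A]
    [AddCommGroup X] [AddCommGroup E] [AddCommGroup B] [Module R A] [Module R X] [Module R E]
    [Module R B] {ι : A →ₗ[R] X} {φ : X →ₗ[R] E} {π : E →ₗ[R] B} (hι : Function.Injective ι)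
    (hιφ : Function.Exact ι φ) (hφπ : Function.Exact φ π) (hπ : Function.Surjective π) {T : R}
    (hT : ∀ e : E, T • e = 0 → e = 0) {D : Submodule R X} (hD : ∀ x, x ∈ D ↔ ∃ y, x = T • y)
    {D' : Submodule R E} (hD' : ∀ x, x ∈ D' ↔ ∃ y, x = T • y) :
    Nat.card ((D'.comap φ).map D.mkQ) = Nat.card (A ⧸ (DistribSMul.toAddMonoidHom A T).range) *
      Nat.card (DistribSMul.toAddMonoidHom B T).ker := by
  rw [← AddMonoidHom.card_map_comap_range (ι := ι.toAddMonoidHom) (φ := φ.toAddMonoidHom)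
    (π := π.toAddMonoidHom) hι hιφ hφπ hπ (tA := DistribSMul.toAddMonoidHom A T)
    (tX := DistribSMul.toAddMonoidHom X T) (tE := DistribSMul.toAddMonoidHom E T)
    (tB := DistribSMul.toAddMonoidHom B T) (fun a => map_smul ι T a) (fun x => map_smul φ T x)
    (fun e => map_smul π T e) ((injective_iff_map_eq_zero _).2 hT) (q := D.mkQ.toAddMonoidHom) (by
      ext x
      refine Iff.trans (Submodule.Quotient.mk_eq_zero _) ((hD x).trans ?_)
      exact exists_congr fun y => eq_comm)]
  have : ((D'.comap φ).map D.mkQ).toAddSubgroup =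
      ((DistribSMul.toAddMonoidHom E T).range.comap φ.toAddMonoidHom).map D.mkQ.toAddMonoidHom := by
    ext y
    constructor
    · rintro ⟨x, hx, rfl⟩
      obtain ⟨e, he⟩ := (hD' _).1 hx
      exact ⟨x, ⟨e, he.symm⟩, rfl⟩
    · rintro ⟨x, ⟨e, he⟩, rfl⟩
      exact ⟨x, (hD' _).2 ⟨e, he.symm⟩, rfl⟩
  rw [← this]
  rfl

/-- If `g ^ n - 1` is injective on `E/TE` for all `n ≠ 0`, then the finite submodules of `X/TX` lie in
the kernel of `X/TX → E/TE`. -/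
theorem ScalarRestriction.le_submodule_of_finite {R' : Type u} {R : Type v} [Ring R'] [Ring R]
    (f : R' →+* R) {X : Type w} {E : Type*} [AddCommGroup X] [AddCommMonoid E] [Module R X]
    [Module R E] (φ : X →ₗ[R] E) {T : R} {D : Submodule R X} (hD : ∀ x, x ∈ D ↔ ∃ y, x = T • y)
    {D' : Submodule R E} (hD' : ∀ x, x ∈ D' ↔ ∃ y, x = T • y) (g : R'ˣ)
    (hg : ∀ n : ℕ, n ≠ 0 → ∀ e : E, (∃ e', (f g ^ n - 1) • e = T • e') → ∃ e', e = T • e')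
    (Y : Submodule R' (ScalarRestriction f (X ⧸ D))) (hY : Finite Y) :
    Y ≤ submodule f ((D'.comap φ).map D.mkQ) := by
  intro y hy
  -- By pigeonhole two powers of g agree on y; as g is a unit, some g^n with n ≥ 1 fixes y.
  obtain ⟨i, j, hij, hfix⟩ := Finite.exists_ne_map_eq_of_infinite
    (fun n : ℕ => (⟨(g : R') ^ n • y, Y.smul_mem _ hy⟩ : Y))
  obtain ⟨n, hn, hfix'⟩ : ∃ n : ℕ, n ≠ 0 ∧ (g : R') ^ n • y = y := by
    have main : ∀ i j : ℕ, i < j → (g : R') ^ i • y = (g : R') ^ j • y →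
        ∃ n : ℕ, n ≠ 0 ∧ (g : R') ^ n • y = y := by
      intro i j hij h
      refine ⟨j - i, by omega, ?_⟩
      have h2 := congrArg (fun c => ((g⁻¹ : R'ˣ) : R') ^ i • c) h
      simp only [smul_smul, ← Units.val_pow_eq_pow_val, ← Units.val_mul] at h2
      rw [inv_pow, inv_mul_cancel, Units.val_one, one_smul, ← Nat.add_sub_cancel' hij.le, pow_add,
        inv_mul_cancel_left] at h2
      rw [← Units.val_pow_eq_pow_val, ← h2]
    rcases lt_or_gt_of_ne hij with h | h
    · exact main i j h (congrArg Subtype.val hfix)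
    · exact main j i h (congrArg Subtype.val hfix).symm
  obtain ⟨x, rfl⟩ := D.mkQ_surjective y
  have h1 : (f g ^ n - 1) • x ∈ D := by
    rw [← Submodule.Quotient.mk_eq_zero, Submodule.Quotient.mk_smul, sub_smul, one_smul,
      sub_eq_zero, ← map_pow]
    exact hfix'
  obtain ⟨x', hx'⟩ := (hD _).1 h1
  have h2 := hg n hn (φ x) ⟨φ x', by rw [← map_smul, hx', map_smul]⟩
  exact ⟨x, (hD' _).2 h2, rfl⟩

/-- If `T` is injective on `E` and `g ^ n - 1` is injective on `E/TE` for all `n ≠ 0`, then `X/TX` has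
a largest finite submodule, which is an extension of the `T`-torsion of `B` by `A/TA`. -/
theorem ScalarRestriction.exists_isGreatest_finite {R' : Type u} {R : Type v} [Ring R'] [Ring R]
    (f : R' →+* R) {X : Type w} {A B : Type*} [AddCommGroup A] [AddCommGroup X]
    [AddCommGroup B] [Module R A] [Module R X] [Module R B] {σ : Type*} (I : σ → Submodule R R)
    {ι : A →ₗ[R] X} {φ : X →ₗ[R] DirectSum σ fun i => R ⧸ I i}
    {π : (DirectSum σ fun i => R ⧸ I i) →ₗ[R] B} (hι : Function.Injective ι)
    (hιφ : Function.Exact ι φ) (hφπ : Function.Exact φ π) (hπ : Function.Surjective π) {T : R}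
    (hT : ∀ e : DirectSum σ fun i => R ⧸ I i, T • e = 0 → e = 0) {D : Submodule R X}
    (hD : ∀ x, x ∈ D ↔ ∃ y, x = T • y) {D' : Submodule R (DirectSum σ fun i => R ⧸ I i)}
    (hD' : ∀ x, x ∈ D' ↔ ∃ y, x = T • y) (g : R'ˣ)
    (hg : ∀ n : ℕ, n ≠ 0 → ∀ e : DirectSum σ fun i => R ⧸ I i,
      (∃ e', (f g ^ n - 1) • e = T • e') → ∃ e', e = T • e')
    (h0 : Nat.card (A ⧸ (DistribSMul.toAddMonoidHom A T).range) *
      Nat.card (DistribSMul.toAddMonoidHom B T).ker ≠ 0) :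
    ∃ X' : Submodule R' (ScalarRestriction f (X ⧸ D)),
      IsGreatest {N : Submodule R' (ScalarRestriction f (X ⧸ D)) | Finite N} X' ∧
      Nat.card X' = Nat.card (A ⧸ (DistribSMul.toAddMonoidHom A T).range) *
        Nat.card (DistribSMul.toAddMonoidHom B T).ker := by
  have hcard := Submodule.card_map_mkQ_comap (E := DirectSum σ fun i => R ⧸ I i) hι hιφ hφπ hπ hT
    hD hD'
  refine ⟨submodule f ((D'.comap φ).map D.mkQ), ⟨?_, ?_⟩, hcard⟩
  · exact Nat.finite_of_card_ne_zero (hcard.trans_ne h0)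
  · intro Y hY
    exact le_submodule_of_finite f φ hD hD' g hg Y hY

/-! ### The main theorem -/

set_option maxHeartbeats 1000000 in
theorem theorem3p1 (p : ℕ) [Fact p.Prime]
    (G : Type u) [Group G] [TopologicalSpace G] [IsTopologicalGroup G]
    [CompactSpace G] [T2Space G] [TotallyDisconnectedSpace G]
    (H Γ : Subgroup G) (hHnormal : H.Normal) (hcompl : H.IsComplement' Γ)
    (hH : Nonempty (H ≃ₜ* Multiplicative ℤ_[p])) (hΓ : Nonempty (Γ ≃ₜ* Multiplicative ℤ_[p])) :
    ∃ (μ_A ν_A ν_B : ModuleCat.{v} (completedGroupAlgebra p G) → ℕ),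
      ∀ (X A B : ModuleCat.{v} (completedGroupAlgebra p G)) (s : ℕ) (k : Fin s → ℕ)
        (ι : A →ₗ[completedGroupAlgebra p G] X)
        (φ : X →ₗ[completedGroupAlgebra p G] ElementaryModule p G k)
        (π : ElementaryModule p G k →ₗ[completedGroupAlgebra p G] B),
        Module.Finite (completedGroupAlgebra p G) X →
        (∀ x : X, ∃ n : ℕ, p ^ n • x = 0) →
        Function.Injective ι → Function.Exact ι φ → Function.Exact φ π → Function.Surjective π →
        Module.Finite (completedGroupAlgebra p H) (RestrictTo p H A) →
        Module.Finite (completedGroupAlgebra p H) (RestrictTo p H B) →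
        ∃ m₀ : ℕ, ∀ m : ℕ, m₀ ≤ m →
          ∃ X' : Submodule (completedGroupAlgebra p Γ)
              (RestrictTo p Γ (Coinvariants p (subgroupPow H (p ^ m)) X)),
            IsGreatest {N : Submodule (completedGroupAlgebra p Γ)
              (RestrictTo p Γ (Coinvariants p (subgroupPow H (p ^ m)) X)) | Finite N} X' ∧
            Nat.card X' = p ^ (μ_A A * p ^ m + ν_A A + ν_B B) := by
  classical
  obtain ⟨eH⟩ := hH
  obtain ⟨eΓ⟩ := hΓ
  have hp0 : p ≠ 0 := (Fact.out : p.Prime).ne_zero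
  let fH : Multiplicative ℤ_[p] →* H := eH.symm.toMulEquiv.toMonoidHom
  let fΓ : Multiplicative ℤ_[p] →* Γ := eΓ.symm.toMulEquiv.toMonoidHom
  have hfH : Continuous fH := eH.symm.continuous
  have hfΓ : Continuous fΓ := eΓ.symm.continuous
  have hfHs : Function.Surjective fH := eH.symm.surjective
  let f : Multiplicative ℤ_[p] →* G := H.subtype.comp fH
  have hf : Continuous f := continuous_subtype_val.comp hfH
  have hf_inj : Function.Injective f := Subtype.val_injective.comp eH.symm.injective
  have hf_range : f.range = H := by
    rw [MonoidHom.range_comp, MonoidHom.range_eq_top.2 hfHs, ← MonoidHom.range_eq_map,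
      Subgroup.range_subtype]
  let fg : Multiplicative ℤ_[p] →* G := Γ.subtype.comp fΓ
  have hfg : Continuous fg := continuous_subtype_val.comp hfΓ
  have hfg_inj : Function.Injective fg := Subtype.val_injective.comp eΓ.symm.injective
  have hcompH : CompactSpace H := eH.symm.toHomeomorph.compactSpace
  let t : H := fH (Multiplicative.ofAdd 1)
  let γ : Γ := fΓ (Multiplicative.ofAdd 1)
  have hcomm : ∀ a b : H, a * b = b * a := fun a b => eH.injective (by
    rw [map_mul, map_mul, mul_comm])
  have hgenH : ∀ (U : OpenNormalSubgroup H) (g : H), ∃ n : ℕ, g * (t ^ n)⁻¹ ∈ U.toSubgroup := by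
    intro U g
    obtain ⟨z, rfl⟩ := hfHs g
    exact PadicInt.exists_mul_inv_pow_mem_of_continuous fH hfH U z
  have hpowH : ∀ U : OpenNormalSubgroup H, ∃ n : ℕ, t ^ p ^ n ∈ U.toSubgroup := fun U =>
    PadicInt.exists_pow_prime_pow_mem_of_continuous fH hfH U _
  let P : ModuleCat.{v} (completedGroupAlgebra p G) → ℕ → ℕ → Prop := fun M μ ν =>
    ∃ m₀ : ℕ, ∀ m, m₀ ≤ m →
      Nat.card (DistribSMul.toAddMonoidHom M
        (completedGroupAlgebra.of p ((t : G) ^ p ^ m) - 1)).ker = p ^ ν ∧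
      Nat.card (M ⧸ (DistribSMul.toAddMonoidHom M
        (completedGroupAlgebra.of p ((t : G) ^ p ^ m) - 1)).range) = p ^ (μ * p ^ m + ν)
  -- The invariants must depend on the module alone, so a pair (μ, ν) is chosen for each M before
  -- any sequence is given; the default 0 is never reached for A or B. One ν serves both, from the
  -- cokernel on A and from the kernel on B.
  let inv : ModuleCat.{v} (completedGroupAlgebra p G) → ℕ × ℕ := fun M =>
    if h : ∃ x : ℕ × ℕ, P M x.1 x.2 then h.choose else 0
  have hinv : ∀ M : ModuleCat.{v} (completedGroupAlgebra p G),
      Module.Finite (completedGroupAlgebra p H) (RestrictTo p H M) →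
      (∀ x : M, ∃ n : ℕ, p ^ n • x = 0) → P M (inv M).1 (inv M).2 := by
    intro M hM hM'
    have h : ∃ x : ℕ × ℕ, P M x.1 x.2 := by
      obtain ⟨μ, ν, h⟩ := completedGroupAlgebra.exists_card_smul_eq hcomm hgenH hpowH M hM hM'
      exact ⟨(μ, ν), h⟩
    simp only [inv, dif_pos h]
    exact h.choose_spec
  refine ⟨fun M => (inv M).1, fun M => (inv M).2, fun M => (inv M).2, ?_⟩
  intro X A B s k ι φ π _ hX hι hιφ hφπ hπ hA hB
  have hA' : ∀ x : A, ∃ n : ℕ, p ^ n • x = 0 := fun x => by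
    obtain ⟨n, hn⟩ := hX (ι x)
    exact ⟨n, hι (by rw [map_nsmul, hn, map_zero])⟩
  have hB' : ∀ x : B, ∃ n : ℕ, p ^ n • x = 0 := fun x => by
    obtain ⟨e, rfl⟩ := hπ x
    obtain ⟨K, hK⟩ := completedGroupAlgebra.exists_pow_nsmul_elementaryModule_eq_zero
      (p := p) (G := G) k
    exact ⟨K, by rw [← map_nsmul, hK, map_zero]⟩
  obtain ⟨mA, hmA⟩ := hinv A hA hA'
  obtain ⟨mB, hmB⟩ := hinv B hB hB'
  refine ⟨max mA mB, fun m hm => ?_⟩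
  obtain ⟨-, cardA⟩ := hmA m ((le_max_left _ _).trans hm)
  obtain ⟨cardB, -⟩ := hmB m ((le_max_right _ _).trans hm)
  set N := subgroupPow H (p ^ m) with hN_def
  set τ : G := (t : G) ^ p ^ m with hτ_def
  have hNnormal : N.Normal := subgroupPow_normal hHnormal _
  obtain ⟨g, hg, hgs, hgf⟩ := exists_subgroupPow_surjective hf hf_range (p ^ m)
  have hgτ : (g (Multiplicative.ofAdd 1) : G) = τ := hgf _
  have hτ : τ ∈ N := hgτ ▸ (g _).2
  have hNcl : IsClosed (N : Set G) := by
    have : CompactSpace N := hgs.compactSpace hg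
    exact (isCompact_iff_compactSpace.2 this).isClosed
  have hgenN : ∀ (U : OpenNormalSubgroup N) (x : N),
      ∃ n : ℕ, x * ((⟨τ, hτ⟩ : N) ^ n)⁻¹ ∈ U.toSubgroup := by
    intro U x
    obtain ⟨z, rfl⟩ := hgs x
    have h1 : (⟨τ, hτ⟩ : N) = g (Multiplicative.ofAdd 1) := Subtype.ext hgτ.symm
    rw [h1]
    exact PadicInt.exists_mul_inv_pow_mem_of_continuous g hg U z
  have hgenG : ∀ (U : OpenNormalSubgroup G), ∀ x ∈ N, ∃ n : ℕ, x * (τ ^ n)⁻¹ ∈ U.toSubgroup :=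
    fun U x hx => hgenN
      (completedGroupAlgebra.comapOpenNormal ⟨N.subtype, continuous_subtype_val⟩ U) ⟨x, hx⟩
  have hpowτ : ∀ U : OpenNormalSubgroup G, ∃ n : ℕ, τ ^ p ^ n ∈ U.toSubgroup := fun U => by
    have := PadicInt.exists_pow_prime_pow_mem_of_continuous f hf U
      (Multiplicative.ofAdd 1 ^ p ^ m)
    rwa [map_pow] at this
  have hordτ := fun k => exists_orderOf_dvd_orderOf (p := p) (N := (⊥ : Subgroup G)) inferInstance
    isClosed_singleton (t := τ) (fun j hj h => PadicInt.pow_ne_one_of_injective hf_inj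
      (mul_ne_zero (pow_ne_zero m hp0) hj) (by rw [pow_mul]; exact h)) hpowτ k
  -- A positive power of γ lying in N ⊆ H would lie in H ∩ Γ = 1, but γ has infinite order.
  have hordγ : ∀ n : ℕ, n ≠ 0 → ∀ k, _ := fun n hn k =>
    exists_orderOf_dvd_orderOf (p := p) hNnormal hNcl (t := (γ : G) ^ n)
      (fun j hj h => by
        rw [← pow_mul] at h
        have h1 : (γ : G) ^ (n * j) ∈ H := subgroupPow_le _ _ h
        have h2 : (γ : G) ^ (n * j) ∈ Γ := pow_mem γ.2 _
        exact PadicInt.pow_ne_one_of_injective hfg_inj (mul_ne_zero hn hj)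
          (Subgroup.disjoint_def.1 hcompl.disjoint h1 h2))
      (fun U => by
        have := PadicInt.exists_pow_prime_pow_mem_of_continuous fg hfg U
          (Multiplicative.ofAdd 1 ^ n)
        rwa [map_pow] at this) k
  have hXaug := completedGroupAlgebra.mem_augmentationSubmodule_iff (p := p) hNnormal hNcl hτ hgenN X
  have hEaug := completedGroupAlgebra.mem_augmentationSubmodule_iff (p := p) hNnormal hNcl hτ hgenN
    (ElementaryModule p G k)
  have hinj := fun e => completedGroupAlgebra.smul_injective_elementaryModule hordτ k e
  have hdiv := fun n hn e => completedGroupAlgebra.exists_eq_smul_elementaryModule hNnormal hτ hgenG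
    (hordγ n hn) k e
  generalize completedGroupAlgebra.of p τ - 1 = T at hXaug hEaug hinj hdiv cardA cardB
  have h := ScalarRestriction.exists_isGreatest_finite (completedGroupAlgebra.ofSubgroup p Γ)
    (fun i => Submodule.span (completedGroupAlgebra p G) {(p : completedGroupAlgebra p G) ^ k i})
    hι hιφ hφπ hπ hinj hXaug hEaug (Units.map (completedGroupAlgebra.of p) (toUnits γ))
    (fun n hn e he => hdiv n hn e (by
      rw [map_pow, ← completedGroupAlgebra.ofSubgroup_of]
      exact he))
    (by rw [cardA, cardB]; exact mul_ne_zero (pow_ne_zero _ hp0) (pow_ne_zero _ hp0))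
  rwa [cardA, cardB, ← pow_add] at h
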